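/- For each $n$ let $f_n:\{0,1\}^{\binom n2}\to\{0,1\}$ be a monotone graph property, i.e. a monotone Boolean function of the edge indicators of a graph on $n$ vertices that takes equal values on isomorphic graphs, and let $f=(f_n)_{n\in\mathbb N}$. Circuits are nonuniform, their size is the number of gates, and negations occur only at the inputs. $\mathsf{NC}^i$ is the class of sequences of Boolean functions computed by circuits of fan-in-two $\land,\lor$-gates of polynomial size and depth $O((\log m)^i)$ in the number $m$ of input bits; $\mathsf{AC}^0$ circuits are circuits of constant depth with unbounded fan-in $\land,\lor$-gates, and $\mathsf{AC}^0[\oplus]$ circuits may also use unbounded fan-in $\oplus$-gates. $\mathsf{NL}$ (resp. $\oplus\mathsf{L}$) is the class of sequences computed by polynomial-time nondeterministic logspace machines that accept an input if some computation path accepts (resp. if the number of accepting computation paths is odd); the input word consists of the edge indicators in lexicographic order, and $n\ge 1$. Say that $f_n$ is a monotone projection of $g_N$ if $f_n$ arises from $g_N$ by replacing each input bit of $g_N$ by a constant or by an unnegated input bit of $f_n$. Then: 1. If $f\in\mathsf{NC}^i$ for an integer $i>1$, then there is a sequence $g=(g_N)_{N\in\mathbb N}$ of monotone graph properties, $g_N$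 on graphs with $N$ vertices, such that $g\in\mathsf{NC}^1$ and, for every $n\ge1$, $f_n$ is a monotone projection of $g_N$ with $N=\lceil 2^{(\log_2 n)^i}\rceil$. 2. If $f\in\mathsf{NL}$, then for every $\varepsilon>0$ there is a sequence $g=(g_N)_{N\in\mathbb N}$ of monotone graph properties, $g_N$ on graphs with $N$ vertices, such that $g$ is computed by $\mathsf{AC}^0$ circuits of size $N^{2+o(1)}$ and, for all sufficiently large $n$, $f_n$ is a monotone projection of $g_N$ with $N=\lceil 2^{n^{\varepsilon}}\rceil$. 3. If $f\in\oplus\mathsf{L}$, then for every $\varepsilon>0$ there is a sequence $g=(g_N)_{N\in\mathbb N}$ of monotone graph properties, $g_N$ on graphs with $N$ vertices, such that $g$ is computed by $\mathsf{AC}^0[\oplus]$ circuits of size $N^{2+o(1)}$ and, for all sufficiently large $n$, $f_n$ is a monotone projection of $g_N$ with $N=\lceil 2^{n^{\varepsilon}}\rceil$. -/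

import Mathlib

open Filter Topology

/-! ## Boolean circuits -/

/-- Gate types; all gates may have arbitrary fan-in. -/
inductive GateOp where
  | and
  | or
  | xor

/-- The value of a gate on a list of input bits (the empty conjunction is `true`, the empty
disjunction and the empty sum modulo 2 are `false`). -/
def GateOp.eval : GateOp → List Bool → Bool
  | .and, l => l.all id
  | .or, l => l.any id
  | .xor, l => l.foldr Bool.xor false

/-- A (nonuniform) Boolean circuit with input variables indexed by `ι`, i.e. a directed acyclic
graph of gates listed in topological order. The inputs of gate `k` are literals `(i, b)`
(the variable `xᵢ` if `b = false`, its negation if `b = true`) or earlier gates. -/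
structure Circuit (ι : Type) where
  /-- The number of gates. -/
  size : ℕ
  op : Fin size → GateOp
  args : (k : Fin size) → List ((ι × Bool) ⊕ Fin (k : ℕ))
  output : (ι × Bool) ⊕ Fin size

namespace Circuit

variable {ι : Type}

/-- The value computed at gate `k` on the input `x`. -/
def gateVal (C : Circuit ι) (x : ι → Bool) (k : Fin C.size) : Bool :=
  (C.op k).eval ((C.args k).map fun a =>
    match a with
    | .inl (i, b) => Bool.xor (x i) b
    | .inr j => C.gateVal x ⟨j, j.isLt.trans k.isLt⟩)
termination_by (k : ℕ)
decreasing_by exact j.isLt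

/-- The value computed by the circuit on the input `x`. -/
def eval (C : Circuit ι) (x : ι → Bool) : Bool :=
  match C.output with
  | .inl (i, b) => Bool.xor (x i) b
  | .inr k => C.gateVal x k

/-- The depth of gate `k`: the number of gates on a longest path ending in it. -/
def gateDepth (C : Circuit ι) (k : Fin C.size) : ℕ :=
  ((C.args k).map fun a =>
    match a with
    | .inl _ => 0
    | .inr j => C.gateDepth ⟨j, j.isLt.trans k.isLt⟩).foldr max 0 + 1
termination_by (k : ℕ)
decreasing_by exact j.isLt

/-- The depth of the circuit (literals have depth `0`). -/
def depth (C : Circuit ι) : ℕ :=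
  match C.output with
  | .inl _ => 0
  | .inr k => C.gateDepth k

/-- The circuit computes the Boolean function `f`. -/
def Computes (C : Circuit ι) (f : (ι → Bool) → Bool) : Prop :=
  ∀ x, C.eval x = f x

/-- The circuit has only `∧`- and `∨`-gates. -/
def IsAndOr (C : Circuit ι) : Prop :=
  ∀ k, C.op k = GateOp.and ∨ C.op k = GateOp.or

/-- Every gate has fan-in at most two. -/
def FanInTwo (C : Circuit ι) : Prop :=
  ∀ k, (C.args k).length ≤ 2

end Circuit

/-- `NC^i`: the family `F` is computed by fan-in two circuits of size `m^{O(1)}` and depth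
`O((log m)^i)`, where `m` is the number of input bits. -/
def InNC (i : ℕ) {ι : ℕ → Type} [∀ n, Fintype (ι n)]
    (F : (n : ℕ) → (ι n → Bool) → Bool) : Prop :=
  ∃ c e : ℕ, ∀ n, ∃ C : Circuit (ι n),
    C.Computes (F n) ∧ C.IsAndOr ∧ C.FanInTwo ∧
      C.size ≤ c * Fintype.card (ι n) ^ e + c ∧
      C.depth ≤ c * Nat.log 2 (Fintype.card (ι n)) ^ i + c

/-- `AC^0[s]`: `F n` is computed by constant-depth circuits with at most `s n` unbounded
fan-in `∧`- and `∨`-gates. -/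
def InAC0 (s : ℕ → ℕ) {ι : ℕ → Type} (F : (n : ℕ) → (ι n → Bool) → Bool) : Prop :=
  ∃ d : ℕ, ∀ n, ∃ C : Circuit (ι n),
    C.Computes (F n) ∧ C.IsAndOr ∧ C.depth ≤ d ∧ C.size ≤ s n

/-- `AC^0[⊕]` with size bound `s`: as `InAC0`, but unbounded fan-in `⊕`-gates are also allowed. -/
def InAC0Xor (s : ℕ → ℕ) {ι : ℕ → Type} (F : (n : ℕ) → (ι n → Bool) → Bool) : Prop :=
  ∃ d : ℕ, ∀ n, ∃ C : Circuit (ι n),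
    C.Computes (F n) ∧ C.depth ≤ d ∧ C.size ≤ s n

/-- `s(N) ≤ N^{2+o(1)}`. -/
def IsAlmostQuadratic (s : ℕ → ℕ) : Prop :=
  ∃ η : ℕ → ℝ, Tendsto η atTop (𝓝 0) ∧ ∀ᶠ N : ℕ in atTop, (s N : ℝ) ≤ (N : ℝ) ^ (2 + η N)

/-- `f` is a monotone projection of `g`: each input bit of `g` is replaced by a constant or by
an (unnegated) input bit of `f`. -/
def IsMonotoneProjection {ι κ : Type} (f : (ι → Bool) → Bool) (g : (κ → Bool) → Bool) : Prop :=
  ∃ ρ : κ → ι ⊕ Bool, ∀ x, f x = g fun k => Sum.elim x id (ρ k)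

/-! ## Nondeterministic logspace machines -/

/-- The symbols on the read-only input tape: end markers and bits. -/
inductive InputSym where
  | leftEnd
  | bit (b : Bool)
  | rightEnd

/-- Head moves. -/
inductive HeadMove where
  | left
  | stay
  | right

/-- The new position of a head on a one-sided tape (a left move in cell `0` has no effect). -/
def HeadMove.apply : HeadMove → ℕ → ℕ
  | .left, p => p - 1
  | .stay, p => p
  | .right, p => p + 1

/-- What a machine does in one step. -/
structure TMAction (Q Γ : Type) where
  newState : Q
  write : Γ
  inputMove : HeadMove
  workMove : HeadMove

/-- A nondeterministic Turing machine with a read-only input tape and a work tape. -/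
structure NTM where
  State : Type
  Symbol : Type
  finiteState : Finite State
  finiteSymbol : Finite Symbol
  start : State
  blank : Symbol
  accept : Set State
  transition : State → InputSym → Symbol → Set (TMAction State Symbol)

namespace NTM

/-- A configuration of the machine. -/
structure Config (M : NTM) where
  state : M.State
  inputPos : ℕ
  workPos : ℕ
  tape : ℕ → M.Symbol

/-- The symbol in cell `p` of the input tape: the left marker is in cell `0`, the word in the cells
`1, …, |w|`, the right marker in cell `|w| + 1`. -/
def inputAt (w : List Bool) : ℕ → InputSym
  | 0 => .leftEnd
  | p + 1 => match w[p]? with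
    | some b => .bit b
    | none => .rightEnd

variable (M : NTM)

/-- The initial configuration. -/
def init : M.Config where
  state := M.start
  inputPos := 0
  workPos := 0
  tape := fun _ => M.blank

/-- The actions available in a configuration on the input word `w`. -/
def actions (w : List Bool) (c : M.Config) : Set (TMAction M.State M.Symbol) :=
  M.transition c.state (inputAt w c.inputPos) (c.tape c.workPos)

/-- The configuration after an action; the input head does not move beyond the end markers. -/
def next (w : List Bool) (c : M.Config) (a : TMAction M.State M.Symbol) : M.Config where
  state := a.newState
  inputPos := min (a.inputMove.apply c.inputPos) (w.length + 1)
  workPos := a.workMove.apply c.workPos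
  tape := Function.update c.tape c.workPos a.write

/-- `M.Run w c l c'`: on the input `w`, the sequence `l` of nondeterministic choices is a
(partial) computation path from `c` to `c'`. -/
inductive Run (w : List Bool) :
    M.Config → List (TMAction M.State M.Symbol) → M.Config → Prop
  | nil (c : M.Config) : Run w c [] c
  | cons {c c' : M.Config} {a : TMAction M.State M.Symbol}
      {l : List (TMAction M.State M.Symbol)}
      (ha : a ∈ M.actions w c) (h : Run w (M.next w c a) l c') : Run w c (a :: l) c'

/-- The accepting paths on the input `w`: the computation paths from the initial configuration
that halt in an accepting state. -/
def acceptingPaths (w : List Bool) : Set (List (TMAction M.State M.Symbol)) :=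
  {l | ∃ c, M.Run w M.init l c ∧ M.actions w c = ∅ ∧ c.state ∈ M.accept}

/-- All computation paths on words `w` have length polynomial in `|w|`. -/
def IsPolyTime : Prop :=
  ∃ p : Polynomial ℕ, ∀ w l c, M.Run w M.init l c → l.length ≤ p.eval w.length

/-- All computation paths on words `w` visit only `O(log |w|)` cells of the work tape. -/
def IsLogSpace : Prop :=
  ∃ k : ℕ, ∀ w l c, M.Run w M.init l c → c.workPos ≤ k * (Nat.log 2 w.length + 1)

end NTM

/-! ## Graphs -/

/-- The `n(n-1)/2` potential edges `{u, v}`, `u < v`, of a graph on `n` vertices. The elements of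
`EdgeVar n → Bool` are the (encodings of) graphs on the vertex set `Fin n`. -/
abbrev EdgeVar (n : ℕ) : Type := {p : Fin n × Fin n // p.1 < p.2}

/-- The graph encoded by `x`. -/
def graphOf {n : ℕ} (x : EdgeVar n → Bool) : SimpleGraph (Fin n) :=
  SimpleGraph.fromRel fun u v => ∃ h : u < v, x ⟨(u, v), h⟩ = true

/-- Graph properties: Boolean functions that agree on isomorphic graphs. -/
def IsGraphProperty {n : ℕ} (f : (EdgeVar n → Bool) → Bool) : Prop :=
  ∀ x y, Nonempty (graphOf x ≃g graphOf y) → f x = f y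

/-- The potential edges in lexicographic order. -/
def edgeList (n : ℕ) : List (EdgeVar n) :=
  (List.finRange n).flatMap fun u =>
    (List.finRange n).filterMap fun v => if h : u < v then some ⟨(u, v), h⟩ else none

/-- The word of length `n(n-1)/2` that a machine gets as its input. -/
def graphWord {n : ℕ} (x : EdgeVar n → Bool) : List Bool := (edgeList n).map x

/-- The sequence `f` is in `NL`. (The graphs with no and with one vertex have the same, empty
encoding, so only graphs with at least one vertex are considered as inputs.) -/
def InNL (f : (n : ℕ) → (EdgeVar n → Bool) → Bool) : Prop :=
  ∃ M : NTM, M.IsPolyTime ∧ M.IsLogSpace ∧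
    ∀ n, 1 ≤ n → ∀ x, f n x = true ↔ (M.acceptingPaths (graphWord x)).Nonempty

/-- The sequence `f` is in `⊕L`: as `InNL`, but an input is accepted if the number of its
accepting paths is odd. -/
def InParityL (f : (n : ℕ) → (EdgeVar n → Bool) → Bool) : Prop :=
  ∃ M : NTM, M.IsPolyTime ∧ M.IsLogSpace ∧
    ∀ n, 1 ≤ n → ∀ x, f n x = true ↔ Odd (M.acceptingPaths (graphWord x)).ncard

/-!
The graph property `f n` is padded to `N` vertices as follows: a graph has the padded property if it
has more than `n` vertices of positive degree, or an induced subgraph on `n` vertices with the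
property `f n` (`padded`). This is a monotone graph property, and adding `N - n` isolated vertices
is a monotone projection from `f n` to it. When `N` is `⌈2 ^ (log n) ^ i⌉` or `⌈2 ^ n ^ ε⌉`, the
number `n` can be recovered from `N` (`ceil_two_rpow_injOn`), so that the padded properties form one
sequence (`paddedFamily`).

It remains to see that the padded property is easy. If the set `S` of vertices of positive degree
has at most `n` elements, then the remainders modulo some number polynomial in `n` and `log N` are
distinct on `S` (`exists_injOn_mod`): otherwise all numbers up to `2 * k`, and therefore the central
binomial coefficient of `k`, would divide the product of the differences in `S`, which is too small.
So for every modulus, in parallel, a circuit of constant depth with about `N ^ 2` gates maps the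
vertices to a small number of cells, and it remains to close the gaps between the occupied cells by
counting the occupied cells before a given one (`comp_compacted`). If all moduli have collisions,
there are more than `n` vertices of positive degree and the answer is `true`; otherwise the value of
`f n` at the compacted graph for a modulus without collision is the answer (`Comp.padded`).

All computations on the compacted graphs have size and depth determined by `n`, which is tiny
compared with `N`. An `NC^i` circuit for `f n` has depth `O((log n) ^ i) = O(log N)`. Counting and
the acceptance of a logspace machine are both expressed by entries of powers of matrices of natural
numbers, the transition matrix of a counting automaton and the matrix of the configuration graph
(`configMatrix_pow`): one asks whether the entry is nonzero, or odd. An entry of the `r`-th power is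
a sum over walks of products, that is, a disjunction or parity of conjunctions
(`Comp.matrix_pow`). If this is iterated `t` times (`Comp.matrix_pow_pow`), the size is about
`m ^ r` for `m` states, and the exponent `r ^ t` has to exceed a polynomial in `n`. With `r = 2`
and `t = O(log n)` this costs depth `O((log n) ^ 2)` in fan-in two, which is the reason for `1 < i`;
with `r` about `n ^ (ε / 2)` and constant `t` it costs size `n ^ O(n ^ (ε / 2)) = N ^ o(1)` in
constant depth.

Circuits are built as straight-line programs whose lines are annotated with the depth for
unbounded fan-in and the depth after conversion to fan-in two (`Comp`).
-/

/-! ### Straight-line programs -/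

namespace GraphPadding

section StraightLinePrograms

open Classical in
/-- The predicate computed by a gate of type `op` whose arguments compute the predicates `l`. -/
def gateSem {ι : Type} (op : GateOp) (l : List ((ι → Bool) → Prop)) (x : ι → Bool) : Prop :=
  op.eval (l.map fun p => decide (p x)) = true

open Classical in
theorem decide_gateSem {ι : Type} (op : GateOp) (l : List ((ι → Bool) → Prop)) (x : ι → Bool) :
    decide (gateSem op l x) = op.eval (l.map fun p => decide (p x)) := by
  rw [Bool.eq_iff_iff, decide_eq_true_iff, gateSem]

/-- A line of a straight-line program: the predicate it computes, an upper bound `depth` for its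
depth with unbounded fan-in, and an upper bound `logDepth` for its depth after every gate of fan-in
`k` has been replaced by a balanced tree of depth at most `⌈log₂ k⌉ + 1`. -/
structure Line (ι : Type) where
  pred : (ι → Bool) → Prop
  depth : ℕ
  logDepth : ℕ

/-- The predicate is a variable or a negated variable. -/
def IsLiteral {ι : Type} (p : (ι → Bool) → Prop) : Prop :=
  ∃ (i : ι) (b : Bool), p = fun x => Bool.xor (x i) b = true

/-- The line `g` is obtained by a single gate from literals and lines in `A`. The pair of the type
and the fan-in of this gate belongs to the basis `B`. -/
def IsGateOver {ι : Type} (B : Set (GateOp × ℕ)) (A : Set (Line ι)) (g : Line ι) : Prop :=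
  ∃ (op : GateOp) (args : List (Line ι)), (op, args.length) ∈ B ∧
    (∀ a ∈ args, a ∈ A ∨ IsLiteral a.pred) ∧
    (∀ x, g.pred x ↔ gateSem op (args.map Line.pred) x) ∧
    (0 < g.depth ∧ ∀ a ∈ args, a.depth < g.depth) ∧
    Nat.clog 2 args.length + 1 ≤ g.logDepth ∧
    ∀ a ∈ args, a.logDepth + Nat.clog 2 args.length + 1 ≤ g.logDepth

/-- A straight-line program: every line is one gate over the preceding lines. -/
def IsSLP {ι : Type} (B : Set (GateOp × ℕ)) (L : List (Line ι)) : Prop :=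
  ∀ (k : ℕ) (h : k < L.length), IsGateOver B {a | a ∈ L.take k} L[k]

variable {ι : Type}

theorem IsGateOver.mono {B B' : Set (GateOp × ℕ)} {A A' : Set (Line ι)} {g : Line ι}
    (h : IsGateOver B A g) (hB : B ⊆ B') (hA : A ⊆ A') : IsGateOver B' A' g := by
  obtain ⟨op, args, h1, h2, h3⟩ := h
  exact ⟨op, args, hB h1, fun a ha => (h2 a ha).imp (fun h => hA h) id, h3⟩

theorem IsSLP.mono {B B' : Set (GateOp × ℕ)} {L : List (Line ι)} (h : IsSLP B L) (hB : B ⊆ B') :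
    IsSLP B' L := fun k hk => (h k hk).mono hB subset_rfl

theorem IsSLP.nil (B : Set (GateOp × ℕ)) : IsSLP B ([] : List (Line ι)) :=
  fun _ h => absurd h (Nat.not_lt_zero _)

/-- Lines that are single gates over a program, possibly using preceding new lines, may be
appended. -/
theorem IsSLP.append {B : Set (GateOp × ℕ)} {L L' : List (Line ι)} (h : IsSLP B L)
    (h' : ∀ (k : ℕ) (hk : k < L'.length), IsGateOver B {a | a ∈ L ∨ a ∈ L'.take k} L'[k]) :
    IsSLP B (L ++ L') := by
  intro k hk
  by_cases hkL : k < L.length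
  · rw [List.getElem_append_left hkL, List.take_append_of_le_length hkL.le]
    exact h k hkL
  · push Not at hkL
    rw [List.getElem_append_right hkL]
    refine (h' (k - L.length) (by simp at hk; omega)).mono subset_rfl ?_
    intro a ha
    rw [Set.mem_ofPred_eq, List.take_append, List.mem_append, List.take_of_length_le hkL]
    exact ha

theorem IsSLP.snoc {B : Set (GateOp × ℕ)} {L : List (Line ι)} {g : Line ι} (h : IsSLP B L)
    (hg : IsGateOver B {a | a ∈ L} g) : IsSLP B (L ++ [g]) := by
  refine h.append fun k hk => ?_
  have : k = 0 := by simpa using hk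
  subst this
  exact hg.mono subset_rfl fun a ha => Or.inl ha

theorem IsSLP.of_snoc {B : Set (GateOp × ℕ)} {L : List (Line ι)} {g : Line ι}
    (h : IsSLP B (L ++ [g])) : IsSLP B L ∧ IsGateOver B {a | a ∈ L} g := by
  constructor
  · intro k hk
    have := h k (by simp; omega)
    rwa [List.getElem_append_left hk, List.take_append_of_le_length hk.le] at this
  · have := h L.length (by simp)
    simpa using this

theorem exists_forall₂_of_forall {α β : Type*} {R : α → β → Prop} (l : List α)
    (h : ∀ a ∈ l, ∃ b, R a b) : ∃ l', List.Forall₂ R l l' := by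
  induction l with
  | nil => exact ⟨[], .nil⟩
  | cons a l ih =>
    obtain ⟨b, hb⟩ := h a (by simp)
    obtain ⟨l', hl'⟩ := ih fun a ha => h a (by simp [ha])
    exact ⟨b :: l', .cons hb hl'⟩

theorem foldr_max_lt {l : List ℕ} {D : ℕ} (hD : 0 < D) (h : ∀ a ∈ l, a < D) :
    l.foldr max 0 < D := by
  induction l with
  | nil => exact hD
  | cons a l ih =>
    simp only [List.foldr_cons]
    exact max_lt (h a (by simp)) (ih fun a ha => h a (by simp [ha]))

theorem le_foldr_max {l : List ℕ} {a : ℕ} (h : a ∈ l) : a ≤ l.foldr max 0 := by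
  induction l with
  | nil => simp at h
  | cons b l ih =>
    simp only [List.foldr_cons]
    rcases List.mem_cons.1 h with rfl | h
    · exact le_max_left _ _
    · exact (ih h).trans (le_max_right _ _)

/-- A straight-line program is a circuit. -/
theorem IsSLP.exists_circuit {B : Set (GateOp × ℕ)} {L : List (Line ι)} (h : IsSLP B L)
    {p : (ι → Bool) → Prop} {D : ℕ} (hp : IsLiteral p ∨ ∃ g ∈ L, g.pred = p ∧ g.depth ≤ D) :
    ∃ C : Circuit ι, C.size = L.length ∧ (∀ k, (C.op k, (C.args k).length) ∈ B) ∧ C.depth ≤ D ∧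
      ∀ x, C.eval x = true ↔ p x := by
  classical
  -- the relation between a line and the wire that carries its value
  let R (k : ℕ) (a : Line ι) (w : (ι × Bool) ⊕ Fin k) : Prop :=
    (∃ i b, w = .inl (i, b) ∧ a.pred = fun x => Bool.xor (x i) b = true) ∨
      ∃ (j : Fin k) (hj : (j : ℕ) < L.length), w = .inr j ∧ L[(j : ℕ)] = a
  have key : ∀ k : Fin L.length, ∃ (op : GateOp) (args : List (Line ι))
      (ws : List ((ι × Bool) ⊕ Fin (k : ℕ))), (op, ws.length) ∈ B ∧
      List.Forall₂ (R k) args ws ∧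
      (∀ x, L[(k : ℕ)].pred x ↔ gateSem op (args.map Line.pred) x) ∧
      0 < L[(k : ℕ)].depth ∧ ∀ a ∈ args, a.depth < L[(k : ℕ)].depth := by
    intro k
    obtain ⟨op, args, h1, h2, h3, h4, -⟩ := h k k.2
    obtain ⟨ws, hws⟩ := exists_forall₂_of_forall (R := R k) args (by
      intro a ha
      rcases h2 a ha with h | ⟨i, b, h⟩
      · obtain ⟨j, hj, e⟩ := List.mem_iff_getElem.1 h
        rw [List.length_take] at hj
        refine ⟨.inr ⟨j, by omega⟩, Or.inr ⟨⟨j, by omega⟩, by simp; omega, rfl, ?_⟩⟩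
        rw [← e, List.getElem_take]
      · exact ⟨.inl (i, b), Or.inl ⟨i, b, rfl, h⟩⟩)
    exact ⟨op, args, ws, hws.length_eq ▸ h1, hws, h3, h4.1, h4.2⟩
  choose op args ws hB hR hsem h0 hdep using key
  let out : (ι × Bool) ⊕ Fin L.length → Prop := fun w =>
    (∃ i b, w = .inl (i, b) ∧ p = fun x => Bool.xor (x i) b = true) ∨
      ∃ j : Fin L.length, w = .inr j ∧ L[(j : ℕ)].pred = p ∧ L[(j : ℕ)].depth ≤ D
  obtain ⟨o, ho⟩ : ∃ o, out o := by
    rcases hp with ⟨i, b, h⟩ | ⟨g, hg, h⟩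
    · exact ⟨.inl (i, b), Or.inl ⟨i, b, rfl, h⟩⟩
    · obtain ⟨j, hj, e⟩ := List.mem_iff_getElem.1 hg
      exact ⟨.inr ⟨j, hj⟩, Or.inr ⟨⟨j, hj⟩, rfl, by simpa [e] using h⟩⟩
  let C : Circuit ι := ⟨L.length, op, ws, o⟩
  have hval : ∀ (x : ι → Bool) (n : ℕ) (k : Fin L.length), (k : ℕ) = n →
      C.gateVal x k = decide (L[(k : ℕ)].pred x) := by
    intro x n
    induction n using Nat.strong_induction_on with
    | _ n ih =>
      intro k hk
      rw [Circuit.gateVal]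
      have : L[(k : ℕ)].pred x = gateSem (op k) ((args k).map Line.pred) x := propext (hsem k x)
      simp only [this, gateSem, Bool.decide_eq_true]
      congr 1
      have hall := hR k
      change List.map _ (ws k) = _
      generalize args k = l at hall
      generalize ws k = l' at hall
      induction hall with
      | nil => rfl
      | @cons a w l l' hw _ ihl =>
        simp only [List.map_cons]
        rw [ihl]
        congr 1
        rcases hw with ⟨i, b, rfl, e⟩ | ⟨j, hj, rfl, e⟩
        · rw [e]
          exact Bool.decide_eq_true.symm
        · have := ih j (by omega) ⟨j, hj⟩ rfl
          simpa [e] using this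
  have hdepth : ∀ (n : ℕ) (k : Fin L.length), (k : ℕ) = n →
      C.gateDepth k ≤ L[(k : ℕ)].depth := by
    intro n
    induction n using Nat.strong_induction_on with
    | _ n ih =>
      intro k hk
      rw [Circuit.gateDepth]
      apply foldr_max_lt (h0 k)
      change ∀ a ∈ List.map _ (ws k), _
      have hall := hR k
      have hd := hdep k
      generalize args k = l at hall hd
      generalize ws k = l' at hall
      induction hall with
      | nil => simp
      | @cons a w l l' hw _ ihl =>
        simp only [List.map_cons, List.forall_mem_cons] at hd ⊢
        refine ⟨?_, ihl hd.2⟩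
        rcases hw with ⟨i, b, rfl, e⟩ | ⟨j, hj, rfl, e⟩
        · exact h0 k
        · have h1 := ih j (by omega) ⟨j, hj⟩ rfl
          have h2 := hd.1
          rw [← e] at h2
          exact lt_of_le_of_lt h1 h2
  refine ⟨C, rfl, fun k => hB k, ?_, fun x => ?_⟩
  · rcases ho with ⟨i, b, rfl, -⟩ | ⟨j, rfl, -, hd⟩
    · exact Nat.zero_le _
    · exact (hdepth _ j rfl).trans hd
  · rcases ho with ⟨i, b, rfl, e⟩ | ⟨j, rfl, e, -⟩
    · simp [C, Circuit.eval, e]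
    · change C.gateVal x j = true ↔ _
      rw [hval x _ j rfl, e]; simp

/-! ### Gates of fan-in two -/

theorem gateEval_append (op : GateOp) (l l' : List Bool) :
    op.eval (l ++ l') = op.eval [op.eval l, op.eval l'] := by
  cases op with
  | and => simp [GateOp.eval]
  | or => simp [GateOp.eval]
  | xor =>
    simp only [GateOp.eval, List.foldr_append, List.foldr_cons, List.foldr_nil, Bool.xor_false]
    induction l with
    | nil => simp
    | cons a l ih => simp [ih]

theorem gateEval_singleton (op : GateOp) (b : Bool) : op.eval [b] = b := by
  cases op <;> simp [GateOp.eval]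

/-- The gates with type in `U` and fan-in at most two. -/
def fanInTwo (U : Set GateOp) : Set (GateOp × ℕ) := {b | b.1 ∈ U ∧ b.2 ≤ 2}

/-- A predicate computed by a literal or by a line of depth at most `D`. -/
def AvailAt (L : List (Line ι)) (D : ℕ) (p : (ι → Bool) → Prop) : Prop :=
  IsLiteral p ∨ ∃ a ∈ L, a.pred = p ∧ a.depth ≤ D ∧ a.logDepth = 2 * a.depth

theorem AvailAt.mono {L L' : List (Line ι)} {D D' : ℕ} {p : (ι → Bool) → Prop}
    (h : AvailAt L D p) (hL : L ⊆ L') (hD : D ≤ D') : AvailAt L' D' p :=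
  h.imp id fun ⟨a, ha, h1, h2, h3⟩ => ⟨a, hL ha, h1, h2.trans hD, h3⟩

/-- A gate of fan-in at most two over available predicates. -/
theorem exists_snoc_fanInTwo {U : Set GateOp} {L : List (Line ι)} (h : IsSLP (fanInTwo U) L)
    {op : GateOp} (hop : op ∈ U) (l : List ((ι → Bool) → Prop)) (hl : l.length ≤ 2) (D : ℕ)
    (hav : ∀ p ∈ l, AvailAt L D p) :
    ∃ L', IsSLP (fanInTwo U) (L ++ L') ∧ L'.length = 1 ∧
      AvailAt (L ++ L') (D + 1) (gateSem op l) := by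
  let R (p : (ι → Bool) → Prop) (a : Line ι) : Prop :=
    a.pred = p ∧ (a ∈ L ∨ IsLiteral a.pred) ∧ a.depth ≤ D ∧ a.logDepth = 2 * a.depth
  obtain ⟨as, has⟩ := exists_forall₂_of_forall (R := R) l (by
    intro p hp
    rcases hav p hp with h | ⟨a, ha, h1, h2⟩
    · exact ⟨⟨p, 0, 0⟩, rfl, Or.inr h, Nat.zero_le _, rfl⟩
    · exact ⟨a, h1, Or.inl ha, h2⟩)
  have hlen := has.length_eq
  have hmap : as.map Line.pred = l := by
    clear hlen hav hl
    induction has with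
    | nil => rfl
    | cons h _ ih => simp [ih, h.1]
  have hall : ∀ a ∈ as, (a ∈ L ∨ IsLiteral a.pred) ∧ a.depth ≤ D ∧ a.logDepth = 2 * a.depth := by
    clear hlen hmap hav hl
    induction has with
    | nil => simp
    | cons h _ ih => simpa [List.forall_mem_cons] using ⟨h.2, ih⟩
  have hclog : Nat.clog 2 as.length ≤ 1 :=
    (Nat.clog_le_iff_le_pow (by norm_num)).2 (by omega)
  refine ⟨[⟨gateSem op l, D + 1, 2 * (D + 1)⟩], h.snoc ?_, rfl,
    Or.inr ⟨⟨gateSem op l, D + 1, 2 * (D + 1)⟩, by simp, rfl, le_rfl, rfl⟩⟩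
  refine ⟨op, as, ⟨hop, by simpa [← hlen] using hl⟩, fun a ha => (hall a ha).1, fun x => ?_,
    ⟨by simp, fun a ha => ?_⟩, ?_, fun a ha => ?_⟩
  · rw [hmap]
  · have := (hall a ha).2.1; simp only; omega
  · simp only; omega
  · have := (hall a ha).2; simp only; omega

/-- A gate of fan-in `k ≥ 1` is a balanced tree of gates of fan-in two. -/
theorem exists_tree_fanInTwo {U : Set GateOp} {op : GateOp} (hop : op ∈ U) (D : ℕ) (n : ℕ) :
    ∀ (l : List ((ι → Bool) → Prop)) (L : List (Line ι)), l.length = n + 1 →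
      IsSLP (fanInTwo U) L → (∀ p ∈ l, AvailAt L D p) →
      ∃ L', IsSLP (fanInTwo U) (L ++ L') ∧ L'.length ≤ n ∧
        AvailAt (L ++ L') (D + Nat.clog 2 (n + 1)) (gateSem op l) := by
  induction n using Nat.strong_induction_on with
  | _ n ih =>
    intro l L hlen hL hav
    rcases Nat.eq_zero_or_pos n with rfl | hn
    · obtain ⟨p, rfl⟩ := List.length_eq_one_iff.1 hlen
      refine ⟨[], by simpa using hL, le_rfl, ?_⟩
      have : gateSem op [p] = p := by
        ext x; simp [gateSem, gateEval_singleton]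
      rw [this]
      exact (hav p (by simp)).mono (by simp) (by simp)
    · -- split into a half of size `⌈(n + 1) / 2⌉` and the rest
      obtain ⟨L₁, h1, c1, a1⟩ := ih (n / 2) (by omega) (l.take (n / 2 + 1)) L
        (by simp; omega) hL fun p hp => hav p (List.mem_of_mem_take hp)
      obtain ⟨L₂, h2, c2, a2⟩ := ih (n - n / 2 - 1) (by omega) (l.drop (n / 2 + 1)) (L ++ L₁)
        (by simp; omega) h1 fun p hp => (hav p (List.mem_of_mem_drop hp)).mono (by simp) le_rfl
      have hc : Nat.clog 2 (n + 1) = Nat.clog 2 (n / 2 + 1) + 1 := by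
        rw [Nat.clog_of_two_le (by norm_num) (by omega)]
        congr 2; omega
      have hc' : Nat.clog 2 (n - n / 2 - 1 + 1) ≤ Nat.clog 2 (n / 2 + 1) :=
        Nat.clog_mono_right 2 (by omega)
      obtain ⟨L₃, h3, c3, a3⟩ := exists_snoc_fanInTwo h2 hop
        [gateSem op (l.take (n / 2 + 1)), gateSem op (l.drop (n / 2 + 1))] (by simp)
        (D + Nat.clog 2 (n / 2 + 1)) (by
          intro p hp
          simp only [List.mem_cons, List.not_mem_nil, or_false] at hp
          rcases hp with rfl | rfl
          · exact a1.mono (by simp) le_rfl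
          · exact a2.mono (by simp) (by omega))
      refine ⟨L₁ ++ L₂ ++ L₃, by simpa using h3, by simp; omega, ?_⟩
      have : gateSem op l =
          gateSem op [gateSem op (l.take (n / 2 + 1)), gateSem op (l.drop (n / 2 + 1))] := by
        ext x
        conv_lhs => rw [← List.take_append_drop (n / 2 + 1) l, gateSem, List.map_append,
          gateEval_append]
        conv_rhs => rw [gateSem, List.map_cons, List.map_cons, List.map_nil, decide_gateSem,
          decide_gateSem]
      rw [this, hc, ← add_assoc]
      simpa using a3

/-- Every straight-line program can be turned into one of fan-in two. -/
theorem IsSLP.exists_fanInTwo {U : Set GateOp} {L : List (Line ι)}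
    (h : IsSLP {b | b.1 ∈ U} L) (E : ℕ) (hE : ∀ a ∈ L, a.logDepth ≤ E) :
    ∃ L', IsSLP (fanInTwo U) L' ∧ L'.length ≤ L.length * 2 ^ E ∧
      ∀ a ∈ L, AvailAt L' a.logDepth a.pred := by
  induction L using List.reverseRecOn with
  | nil => exact ⟨[], IsSLP.nil _, by simp, by simp⟩
  | append_singleton L g ih =>
    obtain ⟨hL, op, args, hop, hargs, hsem, -, hlog0, hlog⟩ := h.of_snoc
    obtain ⟨L', h', hlen, hav⟩ := ih hL fun a ha => hE a (by simp [ha])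
    have hgE : g.logDepth ≤ E := hE g (by simp)
    have hpred : g.pred = gateSem op (args.map Line.pred) := funext fun x => propext (hsem x)
    obtain ⟨L'', h1, h2, h3⟩ : ∃ L'', IsSLP (fanInTwo U) (L' ++ L'') ∧ L''.length ≤ 2 ^ E ∧
        AvailAt (L' ++ L'') g.logDepth g.pred := by
      rw [hpred]
      rcases Nat.eq_zero_or_pos args.length with h0 | h0
      · rw [List.length_eq_zero_iff] at h0
        subst h0
        obtain ⟨L'', h1, h2, h3⟩ := exists_snoc_fanInTwo (D := 0) h' hop [] (by simp) (by simp)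
        exact ⟨L'', h1, h2 ▸ Nat.one_le_two_pow, h3.mono (by simp) (by simp at hlog0; omega)⟩
      · obtain ⟨L'', h1, h2, h3⟩ := exists_tree_fanInTwo hop
          (g.logDepth - Nat.clog 2 args.length - 1) (args.length - 1) (args.map Line.pred) L'
          (by simp; omega) h' (by
            intro p hp
            obtain ⟨a, ha, rfl⟩ := List.mem_map.1 hp
            rcases hargs a ha with h | h
            · exact (hav a h).mono (by simp) (by have := hlog a ha; omega)
            · exact Or.inl h)
        refine ⟨L'', h1, h2.trans ?_, h3.mono (by simp) ?_⟩
        · have : args.length ≤ 2 ^ E :=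
            (Nat.clog_le_iff_le_pow (by norm_num)).1 (by omega)
          omega
        · rw [Nat.sub_add_cancel h0]; omega
    refine ⟨L' ++ L'', h1, ?_, ?_⟩
    · simp only [List.length_append, List.length_singleton, add_mul, one_mul]; omega
    · intro a ha
      rcases List.mem_append.1 ha with ha | ha
      · exact (hav a ha).mono (by simp) le_rfl
      · rw [List.mem_singleton] at ha
        exact ha ▸ h3

/-! ### Sets of predicates computed by bounded-depth programs -/

/-- The predicates in `F` are simultaneously computed by a program with gates of unbounded fan-in
of types in `U`, with at most `s` gates, depth at most `d`, and depth at most `e` after conversion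
to fan-in two. -/
def Comp (U : Set GateOp) (s d e : ℕ) (F : Set ((ι → Bool) → Prop)) : Prop :=
  ∃ L : List (Line ι), IsSLP {b | b.1 ∈ U} L ∧ L.length ≤ s ∧
    (∀ a ∈ L, a.depth ≤ d ∧ a.logDepth ≤ e) ∧
    ∀ p ∈ F, IsLiteral p ∨ ∃ a ∈ L, a.pred = p

variable {U : Set GateOp} {s d e : ℕ} {F : Set ((ι → Bool) → Prop)}

theorem comp_literals (U : Set GateOp) : Comp U 0 0 0 {p : (ι → Bool) → Prop | IsLiteral p} :=
  ⟨[], IsSLP.nil _, by simp, by simp, fun _ hp => Or.inl hp⟩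

theorem Comp.mono {s' d' e' : ℕ} {U' : Set GateOp} {F' : Set ((ι → Bool) → Prop)}
    (h : Comp U s d e F) (hU : U ⊆ U') (hs : s ≤ s') (hd : d ≤ d') (he : e ≤ e') (hF : F' ⊆ F) :
    Comp U' s' d' e' F' := by
  obtain ⟨L, h1, h2, h3, h4⟩ := h
  exact ⟨L, h1.mono fun b hb => hU hb, h2.trans hs,
    fun a ha => ⟨(h3 a ha).1.trans hd, (h3 a ha).2.trans he⟩, fun p hp => h4 p (hF hp)⟩

/-- A layer of gates, each with fan-in at most `w`. -/
theorem Comp.layer (h : Comp U s d e F) {κ : Type*} [Finite κ] (w : ℕ) {G : κ → (ι → Bool) → Prop}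
    (hG : ∀ k, ∃ op ∈ U, ∃ l : List ((ι → Bool) → Prop), l.length ≤ w ∧ (∀ p ∈ l, p ∈ F) ∧
      ∀ x, G k x ↔ gateSem op l x) :
    Comp U (s + Nat.card κ) (d + 1) (e + Nat.clog 2 w + 1) (F ∪ Set.range G) := by
  have := Fintype.ofFinite κ
  obtain ⟨L, h1, h2, h3, h4⟩ := h
  let ln (k : κ) : Line ι := ⟨G k, d + 1, e + Nat.clog 2 w + 1⟩
  have hgate : ∀ k, IsGateOver {b | b.1 ∈ U} {a | a ∈ L} (ln k) := by
    intro k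
    obtain ⟨op, hop, l, hw, hl, hx⟩ := hG k
    let R (p : (ι → Bool) → Prop) (a : Line ι) : Prop :=
      a.pred = p ∧ (a ∈ L ∨ IsLiteral a.pred) ∧ a.depth ≤ d ∧ a.logDepth ≤ e
    obtain ⟨as, has⟩ := exists_forall₂_of_forall (R := R) l (by
      intro p hp
      rcases h4 p (hl p hp) with h | ⟨a, ha, h⟩
      · exact ⟨⟨p, 0, 0⟩, rfl, Or.inr h, Nat.zero_le _, Nat.zero_le _⟩
      · exact ⟨a, h, Or.inl ha, h3 a ha⟩)
    have hlen := has.length_eq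
    have hmap : as.map Line.pred = l := by
      clear hlen hw hx hl
      induction has with
      | nil => rfl
      | cons h _ ih => simp [ih, h.1]
    have hall : ∀ a ∈ as, (a ∈ L ∨ IsLiteral a.pred) ∧ a.depth ≤ d ∧ a.logDepth ≤ e := by
      clear hlen hmap hw hx hl
      induction has with
      | nil => simp
      | cons h _ ih => simpa [List.forall_mem_cons] using ⟨h.2, ih⟩
    have hc : Nat.clog 2 as.length ≤ Nat.clog 2 w := Nat.clog_mono_right 2 (by omega)
    refine ⟨op, as, hop, fun a ha => (hall a ha).1, fun x => ?_, ⟨by simp [ln], fun a ha => ?_⟩, ?_,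
      fun a ha => ?_⟩
    · rw [hmap]; exact hx x
    · have := (hall a ha).2.1; simp only [ln]; omega
    · simp only [ln]; omega
    · have := (hall a ha).2; simp only [ln]; omega
  refine ⟨L ++ (Finset.univ : Finset κ).toList.map ln, h1.append ?_, ?_, ?_, ?_⟩
  · intro k hk
    rw [List.getElem_map]
    exact (hgate _).mono subset_rfl fun a ha => Or.inl ha
  · simp [Nat.card_eq_fintype_card]; omega
  · intro a ha
    rcases List.mem_append.1 ha with ha | ha
    · have := h3 a ha; omega
    · obtain ⟨k, -, rfl⟩ := List.mem_map.1 ha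
      simp [ln]
  · rintro p (hp | ⟨k, rfl⟩)
    · exact (h4 p hp).imp id fun ⟨a, ha, e⟩ => ⟨a, by simp [ha], e⟩
    · exact Or.inr ⟨ln k, by simp, rfl⟩

theorem gateSem_or_toList {J : Type*} [Fintype J] (H : J → (ι → Bool) → Prop) (x : ι → Bool) :
    gateSem .or ((Finset.univ : Finset J).toList.map H) x ↔ ∃ j, H j x := by
  simp [gateSem, GateOp.eval]

theorem gateSem_and_toList {J : Type*} [Fintype J] (H : J → (ι → Bool) → Prop) (x : ι → Bool) :
    gateSem .and ((Finset.univ : Finset J).toList.map H) x ↔ ∀ j, H j x := by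
  simp [gateSem, GateOp.eval]

open Classical in
theorem gateSem_xor_toList {J : Type*} [Fintype J] (H : J → (ι → Bool) → Prop) (x : ι → Bool) :
    gateSem .xor ((Finset.univ : Finset J).toList.map H) x ↔
      Odd (Finset.univ.filter fun j => H j x).card := by
  have key : ∀ l : List Bool, l.foldr Bool.xor false = true ↔ Odd (l.count true) := by
    intro l
    induction l with
    | nil => simp
    | cons a l ih =>
      cases a
      · simpa using ih
      · simp only [List.foldr_cons, Bool.true_xor, List.count_cons_self, Nat.odd_add_one]
        rw [← ih]; simp
  simp only [gateSem, GateOp.eval, List.map_map, key]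
  have : (Finset.univ.filter fun j => H j x).card =
      List.count true ((Finset.univ : Finset J).toList.map fun j => decide (H j x)) := by
    rw [List.count, List.countP_map, Finset.card_def, Finset.filter_val,
      ← Multiset.countP_eq_card_filter, ← Finset.coe_toList, Multiset.coe_countP]
    congr 1
    ext j
    simp
  rw [this]
  rfl

theorem Comp.or_layer (h : Comp U s d e F) (hU : GateOp.or ∈ U) {κ : Type*} [Finite κ] (w : ℕ)
    {J : κ → Type*} [∀ k, Finite (J k)] (H : (k : κ) → J k → (ι → Bool) → Prop)
    (hw : ∀ k, Nat.card (J k) ≤ w) (hH : ∀ k j, H k j ∈ F) :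
    Comp U (s + Nat.card κ) (d + 1) (e + Nat.clog 2 w + 1)
      (F ∪ Set.range fun k x => ∃ j, H k j x) := by
  have := fun k => Fintype.ofFinite (J k)
  refine h.layer w fun k => ⟨.or, hU, Finset.univ.toList.map (H k), ?_, ?_, fun x => ?_⟩
  · simpa [← Nat.card_eq_fintype_card] using hw k
  · simpa using hH k
  · rw [gateSem_or_toList]

theorem Comp.and_layer (h : Comp U s d e F) (hU : GateOp.and ∈ U) {κ : Type*} [Finite κ] (w : ℕ)
    {J : κ → Type*} [∀ k, Finite (J k)] (H : (k : κ) → J k → (ι → Bool) → Prop)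
    (hw : ∀ k, Nat.card (J k) ≤ w) (hH : ∀ k j, H k j ∈ F) :
    Comp U (s + Nat.card κ) (d + 1) (e + Nat.clog 2 w + 1)
      (F ∪ Set.range fun k x => ∀ j, H k j x) := by
  have := fun k => Fintype.ofFinite (J k)
  refine h.layer w fun k => ⟨.and, hU, Finset.univ.toList.map (H k), ?_, ?_, fun x => ?_⟩
  · simpa [← Nat.card_eq_fintype_card] using hw k
  · simpa using hH k
  · rw [gateSem_and_toList]

/-- The gate types `∧` and `∨`. -/
def andOr : Set GateOp := {.and, .or}

theorem IsLiteral.not {p : (ι → Bool) → Prop} (h : IsLiteral p) : IsLiteral fun x => ¬ p x := by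
  obtain ⟨i, b, rfl⟩ := h
  refine ⟨i, !b, ?_⟩
  ext x
  cases h : x i <;> cases b <;> simp [h]

/-- De Morgan duality: with twice as many gates, all the complements are computed as well. -/
theorem Comp.dual (h : Comp andOr s d e F) :
    Comp andOr (2 * s) d e (F ∪ {q | ∃ p ∈ F, q = fun x => ¬ p x}) := by
  obtain ⟨L, h1, h2, h3, h4⟩ := h
  let neg (a : Line ι) : Line ι := ⟨fun x => ¬ a.pred x, a.depth, a.logDepth⟩
  refine ⟨L ++ L.map neg, h1.append ?_, by simp; omega, ?_, ?_⟩
  · intro k hk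
    rw [List.length_map] at hk
    rw [List.getElem_map]
    obtain ⟨op, args, hop, hargs, hsem, hd, hl0, hl⟩ := h1 k hk
    obtain ⟨op', hop', hdual⟩ : ∃ op' ∈ andOr, ∀ x,
        gateSem op' (args.map fun a => (neg a).pred) x ↔ ¬ gateSem op (args.map Line.pred) x := by
      rcases hop with h | h <;> simp only at h <;> subst h
      · exact ⟨.or, by simp [andOr], fun x => by simp [gateSem, GateOp.eval, neg]⟩
      · exact ⟨.and, by simp [andOr], fun x => by simp [gateSem, GateOp.eval, neg]⟩
    refine ⟨op', args.map neg, hop', ?_, ?_, ?_, by simpa [neg] using hl0, by simpa [neg] using hl⟩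
    · intro a ha
      obtain ⟨b, hb, rfl⟩ := List.mem_map.1 ha
      rcases hargs b hb with h | h
      · left; right
        rw [← List.map_take]
        exact List.mem_map_of_mem h
      · exact Or.inr h.not
    · intro x
      rw [List.map_map]
      exact (not_congr (hsem x)).trans (hdual x).symm
    · simpa [neg] using hd
  · intro a ha
    rcases List.mem_append.1 ha with ha | ha
    · exact h3 a ha
    · obtain ⟨b, hb, rfl⟩ := List.mem_map.1 ha
      exact h3 b hb
  · rintro p (hp | ⟨p, hp, rfl⟩)
    · exact (h4 p hp).imp id fun ⟨a, ha, e⟩ => ⟨a, by simp [ha], e⟩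
    · rcases h4 p hp with h | ⟨a, ha, rfl⟩
      · exact Or.inl h.not
      · exact Or.inr ⟨neg a, List.mem_append.2 (Or.inr (List.mem_map_of_mem ha)), rfl⟩

/-- The constants are computed by gates of fan-in zero. -/
theorem Comp.constants (h : Comp U s d e F) (hU : andOr ⊆ U) :
    Comp U (s + 2) (d + 1) (e + 1) (F ∪ {fun _ => True, fun _ => False}) := by
  have := h.layer (κ := Bool) 0 (G := fun b _ => b = true) (by
    rintro (_ | _)
    · exact ⟨.or, hU (by simp [andOr]), [], by simp, by simp, by simp [gateSem, GateOp.eval]⟩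
    · exact ⟨.and, hU (by simp [andOr]), [], by simp, by simp, by simp [gateSem, GateOp.eval]⟩)
  refine this.mono subset_rfl (by simp) le_rfl (by simp) ?_
  rintro p (hp | rfl | rfl)
  · exact Or.inl hp
  · exact Or.inr ⟨true, by simp⟩
  · exact Or.inr ⟨false, by simp⟩

theorem Comp.exists_circuit (h : Comp U s d e F) {p : (ι → Bool) → Prop} (hp : p ∈ F) :
    ∃ C : Circuit ι, C.size ≤ s ∧ (∀ k, C.op k ∈ U) ∧ C.depth ≤ d ∧ ∀ x, C.eval x = true ↔ p x := by
  obtain ⟨L, h1, h2, h3, h4⟩ := h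
  obtain ⟨C, c1, c2, c3, c4⟩ := h1.exists_circuit (D := d) (p := p)
    ((h4 p hp).imp id fun ⟨a, ha, e⟩ => ⟨a, ha, e, (h3 a ha).1⟩)
  exact ⟨C, by omega, fun k => c2 k, c3, c4⟩

theorem Comp.exists_circuit_fanInTwo (h : Comp U s d e F) {p : (ι → Bool) → Prop} (hp : p ∈ F) :
    ∃ C : Circuit ι, C.size ≤ s * 2 ^ e ∧ (∀ k, C.op k ∈ U) ∧ C.FanInTwo ∧ C.depth ≤ e ∧
      ∀ x, C.eval x = true ↔ p x := by
  obtain ⟨L, h1, h2, h3, h4⟩ := h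
  obtain ⟨L', l1, l2, l3⟩ := h1.exists_fanInTwo e fun a ha => (h3 a ha).2
  obtain ⟨C, c1, c2, c3, c4⟩ := l1.exists_circuit (D := e) (p := p) (by
    rcases h4 p hp with h | ⟨a, ha, rfl⟩
    · exact Or.inl h
    · exact (l3 a ha).imp id fun ⟨b, hb, e1, e2, _⟩ => ⟨b, hb, e1, e2.trans (h3 a ha).2⟩)
  exact ⟨C, c1 ▸ l2.trans (Nat.mul_le_mul_right _ h2), fun k => (c2 k).1, fun k => (c2 k).2, c3, c4⟩

theorem mem_gateDepth_lt (C : Circuit ι) (k : Fin C.size) (j : Fin (k : ℕ))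
    (hj : Sum.inr j ∈ C.args k) :
    C.gateDepth ⟨j, j.isLt.trans k.isLt⟩ < C.gateDepth k := by
  conv_rhs => rw [Circuit.gateDepth]
  exact Nat.lt_succ_of_le (le_foldr_max (List.mem_map.2 ⟨_, hj, rfl⟩))

/-- Computed predicates may be substituted for the inputs of a circuit of fan-in two, for several
substitutions `Y k` in parallel. -/
theorem Comp.substitute (h : Comp U s d e F) {κ ν : Type} [Finite κ] (Y : κ → (ι → Bool) → ν → Bool)
    (hY : ∀ k i b, (fun x => Y k x i = b) ∈ F) (C : Circuit ν) (hC : ∀ k, C.op k ∈ U)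
    (hC2 : C.FanInTwo) :
    Comp U (s + C.depth * (Nat.card κ * C.size)) (d + C.depth) (e + 2 * C.depth)
      (F ∪ Set.range fun k x => C.eval (Y k x) = true) := by
  have main : ∀ D : ℕ, Comp U (s + D * (Nat.card κ * C.size)) (d + D) (e + 2 * D)
      (F ∪ {p | ∃ k g, C.gateDepth g ≤ D ∧ p = fun x => C.gateVal (Y k x) g = true}) := by
    intro D
    induction D with
    | zero =>
      refine h.mono subset_rfl (by simp) le_rfl le_rfl ?_
      rintro p (hp | ⟨k, g, hg, -⟩)
      · exact hp
      · rw [Circuit.gateDepth] at hg; omega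
    | succ D ih =>
      have := ih.layer (κ := κ × {g : Fin C.size // C.gateDepth g ≤ D + 1}) 2
        (G := fun kg x => C.gateVal (Y kg.1 x) kg.2.1 = true) (by
          rintro ⟨k, g, hg⟩
          refine ⟨C.op g, hC g, (C.args g).map (fun a x => (match a with
              | .inl (i, b) => Bool.xor (Y k x i) b
              | .inr j => C.gateVal (Y k x) ⟨j, j.isLt.trans g.isLt⟩) = true), ?_, ?_, ?_⟩
          · simpa using hC2 g
          · intro p hp
            obtain ⟨a, ha, rfl⟩ := List.mem_map.1 hp
            rcases a with ⟨i, b⟩ | j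
            · left
              convert hY k i (!b) using 1
              ext x
              simp only
              cases Y k x i <;> cases b <;> simp
            · right
              exact ⟨k, _, Nat.le_of_lt_succ ((mem_gateDepth_lt C g j ha).trans_le hg), rfl⟩
          · intro x
            simp only
            rw [Circuit.gateVal, gateSem, List.map_map]
            simp only [Function.comp_def, Bool.decide_eq_true])
      have hcl : Nat.clog 2 2 = 1 := by decide
      refine this.mono subset_rfl ?_ (by omega) (by omega) ?_
      · rw [Nat.card_prod, add_mul, one_mul, ← add_assoc]
        gcongr
        exact (Finite.card_subtype_le _).trans (Nat.card_fin _).le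
      · rintro p (hp | ⟨k, g, hg, rfl⟩)
        · exact Or.inl (Or.inl hp)
        · exact Or.inr ⟨⟨k, g, hg⟩, rfl⟩
  refine (main C.depth).mono subset_rfl le_rfl le_rfl le_rfl ?_
  rintro p (hp | ⟨k, rfl⟩)
  · exact Or.inl hp
  · rcases ho : C.output with ⟨i, b⟩ | g
    · left
      convert hY k i (!b) using 1
      ext x
      simp only [Circuit.eval, ho]
      cases Y k x i <;> cases b <;> simp
    · right
      refine ⟨k, g, ?_, ?_⟩
      · simp [Circuit.depth, ho]
      · simp [Circuit.eval, ho]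

end StraightLinePrograms

section MatrixPowers

variable {ι : Type}

/-! ### Powers of matrices -/

/-- The entries of a power of a matrix as sums over walks, given by all their vertices. -/
theorem matrix_pow_apply_eq_sum {V : Type*} [Fintype V] [DecidableEq V] (A : Matrix V V ℕ) (r : ℕ)
    (i j : V) :
    (A ^ r) i j = ∑ t : {t : Fin (r + 1) → V // t 0 = i ∧ t (Fin.last r) = j},
      ∏ k : Fin r, A (t.1 k.castSucc) (t.1 k.succ) := by
  have key : ∀ (r : ℕ) (i j : V), (A ^ r) i j = ∑ t : Fin (r + 1) → V,
      if t 0 = i ∧ t (Fin.last r) = j then ∏ k : Fin r, A (t k.castSucc) (t k.succ) else 0 := by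
    intro r
    induction r with
    | zero =>
      intro i j
      rw [← (Equiv.funUnique (Fin 1) V).symm.sum_comp]
      simp [Matrix.one_apply, ite_and]
    | succ r ih =>
      intro i j
      rw [pow_succ', Matrix.mul_apply, ← (Fin.consEquiv fun _ => V).sum_comp, Fintype.sum_prod_type]
      simp only [Fin.consEquiv, Equiv.coe_fn_mk, Fin.cons_zero]
      symm
      rw [Finset.sum_eq_single i]
      · simp only [ih, Finset.mul_sum]
        symm
        rw [Finset.sum_comm]
        refine Finset.sum_congr rfl fun t _ => ?_
        rw [Finset.sum_eq_single (t 0)]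
        · rw [Fin.prod_univ_succ]
          have : (Fin.cons i t : Fin (r + 2) → V) (Fin.last (r + 1)) = t (Fin.last r) := by
            rw [← Fin.succ_last, Fin.cons_succ]
          simp [this]
        · intro k _ hk
          simp [Ne.symm hk]
        · simp
      · intro k _ hk
        simp [hk]
      · simp
  rw [key, ← Finset.sum_filter]
  exact (Finset.sum_subtype _ (by simp) _)

/-- A way to evaluate sums of products of natural numbers by Boolean gates: the predicate `φ`
turns products into conjunctions, and sums into gates of type `op`. -/
structure IsCounting (φ : ℕ → Prop) (op : GateOp) : Prop where
  zero : ¬ φ 0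
  one : φ 1
  prod : ∀ {α : Type} (s : Finset α) (a : α → ℕ), φ (∏ k ∈ s, a k) ↔ ∀ k ∈ s, φ (a k)
  sum : ∀ {ι : Type} {J : Type} [Fintype J] (a : J → (ι → Bool) → ℕ) (x : ι → Bool),
    φ (∑ j, a j x) ↔ gateSem op ((Finset.univ : Finset J).toList.map fun j x => φ (a j x)) x

theorem isCounting_ne_zero : IsCounting (· ≠ 0) .or where
  zero := by simp
  one := by simp
  prod s a := by simp [Finset.prod_ne_zero_iff]
  sum a x := by rw [gateSem_or_toList]; simp

theorem isCounting_odd : IsCounting Odd .xor where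
  zero := by simp
  one := odd_one
  prod s a := by
    classical
    induction s using Finset.induction_on with
    | empty => simp
    | insert b s hb ih => rw [Finset.prod_insert hb, Nat.odd_mul, ih]; simp
  sum a x := by
    classical
    rw [gateSem_xor_toList, Finset.odd_sum_iff_odd_card_odd]
    convert Iff.rfl

variable {U : Set GateOp} {s d e : ℕ} {F : Set ((ι → Bool) → Prop)}

/-- One layer of conjunctions over walks and one layer of `op`-gates compute the `r`-th powers of
a family of matrices. -/
theorem Comp.matrix_pow (h : Comp U s d e F) (hand : GateOp.and ∈ U) {φ : ℕ → Prop} {op : GateOp}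
    (hφ : IsCounting φ op) (hop : op ∈ U) {κ V : Type} [Finite κ] [Fintype V] [DecidableEq V]
    (A : κ → (ι → Bool) → Matrix V V ℕ) (hA : ∀ k i j, (fun x => φ (A k x i j)) ∈ F) (r : ℕ) :
    Comp U (s + Nat.card κ * (Fintype.card V ^ (r + 1) + Fintype.card V ^ 2)) (d + 2)
      (e + (Nat.clog 2 r + Nat.clog 2 (Fintype.card V ^ (r + 1)) + 2))
      (F ∪ {p | ∃ k i j, p = fun x => φ ((A k x ^ r) i j)}) := by
  have h1 := h.and_layer hand (κ := κ × (Fin (r + 1) → V)) (J := fun _ => Fin r) r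
    (fun k j x => φ (A k.1 x (k.2 j.castSucc) (k.2 j.succ))) (by simp) (fun k j => hA _ _ _)
  have h2 := h1.layer (κ := κ × V × V) (Fintype.card V ^ (r + 1))
    (G := fun k x => φ ((A k.1 x ^ r) k.2.1 k.2.2)) (by
      rintro ⟨k, i, j⟩
      let T := {t : Fin (r + 1) → V // t 0 = i ∧ t (Fin.last r) = j}
      refine ⟨op, hop, (Finset.univ : Finset T).toList.map fun t x =>
        φ (∏ l : Fin r, A k x (t.1 l.castSucc) (t.1 l.succ)), ?_, ?_, fun x => ?_⟩
      · have : Fintype.card T ≤ Fintype.card (Fin (r + 1) → V) := Fintype.card_subtype_le _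
        simpa using this
      · intro p hp
        obtain ⟨t, -, rfl⟩ := List.mem_map.1 hp
        refine Or.inr ⟨(k, t.1), ?_⟩
        ext x
        simp [hφ.prod]
      · simp only [matrix_pow_apply_eq_sum]
        exact hφ.sum (fun (t : T) x => ∏ l : Fin r, A k x (t.1 l.castSucc) (t.1 l.succ)) x)
  refine h2.mono subset_rfl ?_ le_rfl (by omega) ?_
  · simp only [Nat.card_prod, Nat.card_eq_fintype_card (α := V), Nat.card_fun,
      Nat.card_eq_fintype_card (α := Fin _),
      Fintype.card_fin]
    apply le_of_eq; ring
  · rintro p (hp | ⟨k, i, j, rfl⟩)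
    · exact Or.inl (Or.inl hp)
    · exact Or.inr ⟨(k, i, j), rfl⟩

/-- Iterated powers: the power `r ^ t` is computed in depth `2 * t`. -/
theorem Comp.matrix_pow_pow (h : Comp U s d e F) (hand : GateOp.and ∈ U) {φ : ℕ → Prop}
    {op : GateOp} (hφ : IsCounting φ op) (hop : op ∈ U) {κ V : Type} [Finite κ] [Fintype V]
    [DecidableEq V] (A : κ → (ι → Bool) → Matrix V V ℕ)
    (hA : ∀ k i j, (fun x => φ (A k x i j)) ∈ F) (r t : ℕ) :
    Comp U (s + t * (Nat.card κ * (Fintype.card V ^ (r + 1) + Fintype.card V ^ 2))) (d + 2 * t)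
      (e + t * (Nat.clog 2 r + Nat.clog 2 (Fintype.card V ^ (r + 1)) + 2))
      (F ∪ {p | ∃ k i j, p = fun x => φ ((A k x ^ r ^ t) i j)}) := by
  induction t with
  | zero =>
    refine h.mono subset_rfl (by simp) (by simp) (by simp) ?_
    rintro p (hp | ⟨k, i, j, rfl⟩)
    · exact hp
    · simpa using hA k i j
  | succ t ih =>
    have := ih.matrix_pow hand hφ hop (fun k x => A k x ^ r ^ t)
      (fun k i j => Or.inr ⟨k, i, j, rfl⟩) r
    refine this.mono subset_rfl (by rw [add_mul, one_mul, add_assoc]) (by omega)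
      (by rw [add_mul, one_mul, add_assoc]) ?_
    rintro p (hp | ⟨k, i, j, rfl⟩)
    · exact Or.inl (Or.inl hp)
    · exact Or.inr ⟨k, i, j, by simp only [← pow_mul, ← pow_succ]⟩

/-! ### Exact counting -/

open Classical in
/-- The transition matrix of the automaton that reads the bits `o 0, …, o (q - 1)` and counts the
ones: its states are the pairs of a position and a number of ones, and a run dies as soon as it
has seen more than `n` ones. -/
noncomputable def countMatrix (q n : ℕ) (o : Fin q → Prop) :
    Matrix (Fin (q + 1) × Fin (n + 1)) (Fin (q + 1) × Fin (n + 1)) ℕ := fun u v =>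
  if h : (u.1 : ℕ) < q then
    if (v.1 : ℕ) = u.1 + 1 ∧ (v.2 : ℕ) = u.2 + if o ⟨u.1, h⟩ then 1 else 0 then 1 else 0
  else if u = v then 1 else 0

open Classical in
/-- The number of ones among the first `l` bits. -/
noncomputable def countBelow {q : ℕ} (o : Fin q → Prop) (l : ℕ) : ℕ :=
  (Finset.univ.filter fun k : Fin q => (k : ℕ) < l ∧ o k).card

theorem countBelow_zero {q : ℕ} (o : Fin q → Prop) : countBelow o 0 = 0 := by
  simp [countBelow]

open Classical in
theorem countBelow_succ {q : ℕ} (o : Fin q → Prop) (l : ℕ) (hl : l < q) :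
    countBelow o (l + 1) = countBelow o l + if o ⟨l, hl⟩ then 1 else 0 := by
  unfold countBelow
  split_ifs with h
  · rw [← Finset.card_insert_of_notMem (a := ⟨l, hl⟩) (by simp)]
    congr 1
    ext k
    simp only [Finset.mem_filter, Finset.mem_univ, true_and, Finset.mem_insert, Fin.ext_iff]
    constructor
    · rintro ⟨h1, h2⟩
      by_cases hk : (k : ℕ) = l
      · exact Or.inl hk
      · exact Or.inr ⟨by omega, h2⟩
    · rintro (h1 | h1)
      · refine ⟨by omega, ?_⟩
        rwa [show k = ⟨l, hl⟩ from Fin.ext h1]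
      · exact ⟨by omega, h1.2⟩
  · rw [add_zero]
    congr 1
    ext k
    simp only [Finset.mem_filter, Finset.mem_univ, true_and]
    refine ⟨fun ⟨h1, h2⟩ => ⟨?_, h2⟩, fun h1 => ⟨by omega, h1.2⟩⟩
    by_contra hk
    exact h (by rwa [show (⟨l, hl⟩ : Fin q) = k from Fin.ext (by simp; omega)])

theorem countBelow_mono {q : ℕ} (o : Fin q → Prop) {l l' : ℕ} (h : l ≤ l') :
    countBelow o l ≤ countBelow o l' := by
  classical
  apply Finset.card_le_card
  intro k
  simp only [Finset.mem_filter, Finset.mem_univ, true_and]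
  exact fun hk => ⟨by omega, hk.2⟩

theorem countMatrix_pow_ne_zero (q n : ℕ) (o : Fin q → Prop) (l : ℕ)
    (v : Fin (q + 1) × Fin (n + 1)) :
    (countMatrix q n o ^ l) (0, 0) v ≠ 0 ↔
      (v.1 : ℕ) = min l q ∧ (v.2 : ℕ) = countBelow o (min l q) := by
  classical
  induction l generalizing v with
  | zero =>
    rw [pow_zero, Matrix.one_apply]
    rw [Nat.zero_min, countBelow_zero]
    simp only [ne_eq, ite_eq_right_iff, one_ne_zero, imp_false, not_not, Prod.ext_iff, Fin.ext_iff,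
      Fin.val_zero]
    exact and_congr eq_comm eq_comm
  | succ l ih =>
    rw [pow_succ, Matrix.mul_apply, ne_eq, Finset.sum_eq_zero_iff]
    push Not
    simp only [Finset.mem_univ, true_and, mul_ne_zero_iff, ih]
    by_cases hl : l < q
    · rw [min_eq_left hl.le, min_eq_left (by omega : l + 1 ≤ q), countBelow_succ o l hl]
      constructor
      · rintro ⟨u, ⟨h1, h2⟩, h3⟩
        rw [countMatrix, dif_pos (by omega)] at h3
        simp only [h1, h2] at h3
        simpa using h3
      · rintro ⟨h1, h2⟩
        have hc : countBelow o l < n + 1 := by have := v.2.2; omega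
        refine ⟨(⟨l, by omega⟩, ⟨countBelow o l, hc⟩), ⟨rfl, rfl⟩, ?_⟩
        rw [countMatrix, dif_pos (by simpa using hl)]
        simp [h1, h2]
    · rw [min_eq_right (by omega), min_eq_right (by omega)]
      constructor
      · rintro ⟨u, ⟨h1, h2⟩, h3⟩
        rw [countMatrix, dif_neg (by omega)] at h3
        have : u = v := by simpa using h3
        subst this
        exact ⟨h1, h2⟩
      · intro h
        refine ⟨v, h, ?_⟩
        rw [countMatrix, dif_neg (by omega)]
        simp

/-- The number of ones among the first `l k` of `q` computed bits is compared with every `a ≤ n`.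
The exponent `r ^ t` has to be at least `q`, so that every run reaches its last position. -/
theorem Comp.count (h : Comp U s d e F) (hU : andOr ⊆ U) {κ : Type} [Finite κ] {q : ℕ} (n r t : ℕ)
    (hq : q ≤ r ^ t) (o : κ → (ι → Bool) → Fin q → Prop)
    (ho : ∀ k c, (fun x => o k x c) ∈ F) (ho' : ∀ k c, (fun x => ¬ o k x c) ∈ F)
    (hT : (fun _ => True) ∈ F) (hF : (fun _ => False) ∈ F) :
    Comp U (s + t * (Nat.card κ * (((q + 1) * (n + 1)) ^ (r + 1) + ((q + 1) * (n + 1)) ^ 2)))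
      (d + 2 * t) (e + t * (Nat.clog 2 r + Nat.clog 2 (((q + 1) * (n + 1)) ^ (r + 1)) + 2))
      (F ∪ {p | ∃ (k : κ) (a : Fin (n + 1)), p = fun x => (a : ℕ) = countBelow (o k x) q}) := by
  classical
  have := h.matrix_pow_pow (hU (by simp [andOr])) isCounting_ne_zero (hU (by simp [andOr]))
    (fun k x => countMatrix q n (o k x)) (by
      intro k u v
      by_cases hu : (u.1 : ℕ) < q
      · by_cases hv : (v.1 : ℕ) = u.1 + 1
        · by_cases h1 : (v.2 : ℕ) = u.2 + 1
          · convert ho k ⟨u.1, hu⟩ using 1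
            ext x
            simp [countMatrix, hu, hv, h1]
          · by_cases h2 : (v.2 : ℕ) = u.2
            · convert ho' k ⟨u.1, hu⟩ using 1
              ext x
              simp [countMatrix, hu, hv, h2]
            · convert hF using 1
              ext x
              simp only [countMatrix, hu, hv]
              split_ifs <;> simp_all
        · convert hF using 1
          ext x
          simp [countMatrix, hu, hv]
      · by_cases huv : u = v
        · convert hT using 1
          ext x
          simp [countMatrix, huv ▸ hu, huv]
        · convert hF using 1
          ext x
          simp [countMatrix, hu, huv]) r t
  simp only [Fintype.card_prod, Fintype.card_fin] at this
  refine this.mono subset_rfl le_rfl le_rfl le_rfl ?_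
  rintro p (hp | ⟨k, a, rfl⟩)
  · exact Or.inl hp
  · refine Or.inr ⟨k, (0, 0), (Fin.last q, a), ?_⟩
    ext x
    rw [countMatrix_pow_ne_zero, min_eq_right hq]
    simp

end MatrixPowers

/-! ### Padding a monotone graph property -/

theorem graphOf_adj {N : ℕ} (x : EdgeVar N → Bool) {u v : Fin N} (h : u < v) :
    (graphOf x).Adj u v ↔ x ⟨(u, v), h⟩ = true := by
  simp only [graphOf, SimpleGraph.fromRel_adj]
  constructor
  · rintro ⟨-, ⟨_, h'⟩ | ⟨h', -⟩⟩
    · exact h'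
    · exact absurd h h'.asymm
  · exact fun h' => ⟨h.ne, Or.inl ⟨h, h'⟩⟩

open Classical in
/-- The encoding of a graph on `Fin n` by its edge indicators. -/
noncomputable def encode {n : ℕ} (G : SimpleGraph (Fin n)) : EdgeVar n → Bool :=
  fun e => decide (G.Adj e.1.1 e.1.2)

theorem graphOf_encode {n : ℕ} (G : SimpleGraph (Fin n)) : graphOf (encode G) = G := by
  ext u v
  rcases lt_trichotomy u v with h | rfl | h
  · rw [graphOf_adj _ h]; simp [encode]
  · simp
  · rw [SimpleGraph.adj_comm, graphOf_adj _ h, G.adj_comm]; simp [encode]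

theorem encode_graphOf {n : ℕ} (x : EdgeVar n → Bool) : encode (graphOf x) = x := by
  ext ⟨⟨u, v⟩, h⟩
  rw [Bool.eq_iff_iff]
  simp [encode, graphOf_adj x h]

theorem encode_mono {n : ℕ} {G H : SimpleGraph (Fin n)} (h : G ≤ H) : encode G ≤ encode H := by
  intro e
  rw [Bool.le_iff_imp]
  simpa [encode] using fun h' => h h'

theorem graphOf_mono {n : ℕ} {x y : EdgeVar n → Bool} (h : x ≤ y) : graphOf x ≤ graphOf y := by
  intro u v huv
  rcases lt_trichotomy u v with hl | rfl | hl
  · rw [graphOf_adj _ hl] at huv ⊢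
    exact Bool.le_iff_imp.1 (h _) huv
  · simp at huv
  · rw [SimpleGraph.adj_comm, graphOf_adj _ hl] at huv ⊢
    exact Bool.le_iff_imp.1 (h _) huv

open Classical in
/-- The vertices of positive degree. -/
noncomputable def nonisolated {N : ℕ} (G : SimpleGraph (Fin N)) : Finset (Fin N) :=
  Finset.univ.filter fun u => ∃ v, G.Adj u v

theorem mem_nonisolated {N : ℕ} {G : SimpleGraph (Fin N)} {u : Fin N} :
    u ∈ nonisolated G ↔ ∃ v, G.Adj u v := by
  simp [nonisolated]

open Classical in
/-- The padded version on `N` vertices of a graph property `f` on `n` vertices: a graph has it if it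
has more than `n` vertices of positive degree or an induced subgraph on `n` vertices with the
property `f`. -/
noncomputable def padded {n : ℕ} (f : (EdgeVar n → Bool) → Bool) (N : ℕ) :
    (EdgeVar N → Bool) → Bool := fun x =>
  decide (n < (nonisolated (graphOf x)).card ∨
    ∃ φ : Fin n ↪ Fin N, f (encode ((graphOf x).comap φ)) = true)

theorem padded_monotone {n : ℕ} {f : (EdgeVar n → Bool) → Bool} (hf : Monotone f) (N : ℕ) :
    Monotone (padded f N) := by
  intro x y hxy
  have hG := graphOf_mono hxy
  rw [Bool.le_iff_imp]
  simp only [padded, decide_eq_true_eq]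
  rintro (h | ⟨φ, h⟩)
  · left
    refine h.trans_le (Finset.card_le_card fun u hu => ?_)
    rw [mem_nonisolated] at hu ⊢
    exact hu.imp fun v hv => hG hv
  · exact Or.inr ⟨φ, Bool.le_iff_imp.1 (hf (encode_mono fun u v h => hG h)) h⟩

theorem padded_isGraphProperty {n : ℕ} (f : (EdgeVar n → Bool) → Bool) (N : ℕ) :
    IsGraphProperty (padded f N) := by
  have key : ∀ x y : EdgeVar N → Bool, (graphOf x ≃g graphOf y) →
      padded f N x = true → padded f N y = true := by
    intro x y σ
    simp only [padded, decide_eq_true_eq]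
    rintro (h | ⟨φ, h⟩)
    · left
      refine h.trans_le (Finset.card_le_card_of_injOn σ (fun u hu => ?_) σ.injective.injOn)
      rw [Finset.mem_coe, mem_nonisolated] at hu ⊢
      obtain ⟨v, hv⟩ := hu
      exact ⟨σ v, σ.map_adj_iff.2 hv⟩
    · refine Or.inr ⟨φ.trans σ.toEquiv.toEmbedding, ?_⟩
      rw [← h]
      congr 2
      ext u v
      exact σ.map_adj_iff
  rintro x y ⟨σ⟩
  rw [Bool.eq_iff_iff]
  exact ⟨key x y σ, key y x σ.symm⟩

/-- If the vertices of positive degree are mapped injectively to `Fin n`, then the padded property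
of a graph is the original property of its image. -/
theorem padded_eq {n N : ℕ} (hnN : n ≤ N) {f : (EdgeVar n → Bool) → Bool} (hf : Monotone f)
    (hf' : IsGraphProperty f) (x : EdgeVar N → Bool) (ρ : Fin N → Fin n)
    (hρ : Set.InjOn ρ (nonisolated (graphOf x))) (y : EdgeVar n → Bool)
    (hy : ∀ e, y e = true ↔ ∃ u v, (graphOf x).Adj u v ∧ ρ u = e.1.1 ∧ ρ v = e.1.2) :
    padded f N x = f y := by
  classical
  set G := graphOf x
  have hadj : ∀ a b, (graphOf y).Adj a b ↔ ∃ u v, G.Adj u v ∧ ρ u = a ∧ ρ v = b := by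
    intro a b
    rcases lt_trichotomy a b with h | rfl | h
    · rw [graphOf_adj _ h, hy]
    · simp only [SimpleGraph.irrefl, false_iff]
      rintro ⟨u, v, h, h1, h2⟩
      exact h.ne (hρ (mem_nonisolated.2 ⟨v, h⟩) (mem_nonisolated.2 ⟨u, h.symm⟩) (h1.trans h2.symm))
    · rw [SimpleGraph.adj_comm, graphOf_adj _ h, hy]
      constructor <;> rintro ⟨u, v, h, h1, h2⟩ <;> exact ⟨v, u, h.symm, h2, h1⟩
  rw [Bool.eq_iff_iff, padded, decide_eq_true_eq]
  constructor
  · rintro (h | ⟨φ, h⟩)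
    · have := Finset.card_le_card_of_injOn (t := (Finset.univ : Finset (Fin n))) ρ (by simp) hρ
      rw [Finset.card_univ, Fintype.card_fin] at this
      exact absurd h this.not_gt
    · -- extend `ρ ∘ φ` to a permutation of `Fin n`
      obtain ⟨π, hπ⟩ := Finset.exists_equiv_extend_of_card_eq (α := Fin n)
        (t := (Finset.univ : Finset (Fin n))) (by simp)
        (s := Finset.univ.filter fun i => φ i ∈ nonisolated G) (f := fun i => ρ (φ i)) (by simp)
        (by
          intro i hi j hj hij
          simp only [Finset.coe_filter, Finset.mem_univ, true_and, Set.mem_ofPred_eq] at hi hj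
          exact φ.injective (hρ hi hj hij))
      let π' : Fin n ≃ Fin n := π.trans (Equiv.subtypeUnivEquiv (by simp))
      have hπ' : ∀ i, φ i ∈ nonisolated G → π' i = ρ (φ i) := fun i hi => hπ i (by simpa using hi)
      have hle : G.comap φ ≤ (graphOf y).comap π' := by
        intro i j hij
        have hij' : G.Adj (φ i) (φ j) := hij
        rw [SimpleGraph.comap_adj, hadj, hπ' i (mem_nonisolated.2 ⟨_, hij'⟩),
          hπ' j (mem_nonisolated.2 ⟨_, hij'.symm⟩)]
        exact ⟨_, _, hij', rfl, rfl⟩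
      have h1 := Bool.le_iff_imp.1 (hf (encode_mono hle)) h
      rw [← h1]
      refine (hf' _ _ ⟨?_⟩).symm
      rw [graphOf_encode]
      exact ⟨π', by simp⟩
  · intro h
    right
    -- extend the inverse of `ρ` to an embedding of `Fin n`
    obtain ⟨ψ, hψ⟩ : ∃ ψ : Fin n → Fin N, ∀ u ∈ nonisolated G, ψ (ρ u) = u := by
      refine ⟨fun a => if h : ∃ u ∈ nonisolated G, ρ u = a then h.choose else
        Fin.castLE hnN a, fun u hu => ?_⟩
      have h : ∃ u' ∈ nonisolated G, ρ u' = ρ u := ⟨u, hu, rfl⟩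
      beta_reduce
      rw [dif_pos h]
      exact hρ h.choose_spec.1 hu h.choose_spec.2
    set s := (nonisolated G).image ρ
    have hinj : Set.InjOn ψ s := by
      intro a ha b hb hab
      obtain ⟨u, hu, rfl⟩ := Finset.mem_image.1 ha
      obtain ⟨v, hv, rfl⟩ := Finset.mem_image.1 hb
      rw [hψ u hu, hψ v hv] at hab
      rw [hab]
    obtain ⟨t, ht1, -, ht2⟩ := Finset.exists_subsuperset_card_eq (Finset.subset_univ (s.image ψ))
      (n := n) (Finset.card_image_le.trans ((Finset.card_le_univ s).trans (by simp)))
      (by simpa using hnN)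
    obtain ⟨π, hπ⟩ := Finset.exists_equiv_extend_of_card_eq (α := Fin n) (t := t) (by simp [ht2])
      ht1 hinj
    refine ⟨π.toEmbedding.trans (Function.Embedding.subtype _), ?_⟩
    rw [← encode_graphOf y] at h
    refine Bool.le_iff_imp.1 (hf (encode_mono ?_)) h
    intro a b hab
    obtain ⟨u, v, huv, rfl, rfl⟩ := (hadj a b).1 hab
    have hu : u ∈ nonisolated G := mem_nonisolated.2 ⟨_, huv⟩
    have hv : v ∈ nonisolated G := mem_nonisolated.2 ⟨_, huv.symm⟩
    change G.Adj (π (ρ u)) (π (ρ v))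
    rw [hπ _ (Finset.mem_image_of_mem ρ hu), hπ _ (Finset.mem_image_of_mem ρ hv), hψ u hu, hψ v hv]
    exact huv

/-- Adding isolated vertices is a monotone projection from the property to its padded version. -/
theorem isMonotoneProjection_padded {n N : ℕ} (hnN : n ≤ N) {f : (EdgeVar n → Bool) → Bool}
    (hf : Monotone f) (hf' : IsGraphProperty f) (hn : 0 < n) :
    IsMonotoneProjection f (padded f N) := by
  refine ⟨fun e => if h : (e.1.2 : ℕ) < n then
    Sum.inl ⟨(⟨e.1.1, lt_trans e.2 h⟩, ⟨e.1.2, h⟩), e.2⟩ else Sum.inr false, fun x => ?_⟩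
  set z : EdgeVar N → Bool := _
  change f x = padded f N z
  have hz : ∀ e : EdgeVar N, z e = true ↔
      ∃ h : (e.1.2 : ℕ) < n, x ⟨(⟨e.1.1, lt_trans e.2 h⟩, ⟨e.1.2, h⟩), e.2⟩ = true := by
    intro e
    by_cases h : (e.1.2 : ℕ) < n <;> simp [z, h]
  have hzadj : ∀ u v : Fin N, (graphOf z).Adj u v ↔
      ∃ (hu : (u : ℕ) < n) (hv : (v : ℕ) < n), (graphOf x).Adj ⟨u, hu⟩ ⟨v, hv⟩ := by
    have hlt : ∀ u v : Fin N, u < v → ((graphOf z).Adj u v ↔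
        ∃ (hu : (u : ℕ) < n) (hv : (v : ℕ) < n), (graphOf x).Adj ⟨u, hu⟩ ⟨v, hv⟩) := by
      intro u v h
      rw [graphOf_adj _ h, hz]
      constructor
      · rintro ⟨hv, hx⟩
        exact ⟨lt_trans h hv, hv, (graphOf_adj x (by exact h)).2 hx⟩
      · rintro ⟨hu, hv, hx⟩
        exact ⟨hv, (graphOf_adj x (by exact h)).1 hx⟩
    intro u v
    rcases lt_trichotomy u v with h | rfl | h
    · exact hlt u v h
    · simp
    · rw [SimpleGraph.adj_comm, hlt v u h]
      constructor <;> rintro ⟨h1, h2, h3⟩ <;> exact ⟨h2, h1, h3.symm⟩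
  symm
  apply padded_eq hnN hf hf' z (fun u => if h : (u : ℕ) < n then ⟨u, h⟩ else ⟨0, hn⟩)
  · intro u hu v hv huv
    obtain ⟨u', hu'⟩ := mem_nonisolated.1 hu
    obtain ⟨v', hv'⟩ := mem_nonisolated.1 hv
    obtain ⟨hun, -, -⟩ := (hzadj _ _).1 hu'
    obtain ⟨hvn, -, -⟩ := (hzadj _ _).1 hv'
    simp only [dif_pos hun, dif_pos hvn, Fin.mk.injEq] at huv
    exact Fin.ext huv
  · rintro ⟨⟨a, b⟩, hab⟩
    rw [← graphOf_adj x hab]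
    constructor
    · intro h
      exact ⟨Fin.castLE hnN a, Fin.castLE hnN b, (hzadj _ _).2 ⟨a.2, b.2, h⟩, by simp, by simp⟩
    · rintro ⟨u, v, huv, rfl, rfl⟩
      obtain ⟨hu, hv, h⟩ := (hzadj _ _).1 huv
      simpa [hu, hv] using h

/-! ### Hashing by remainders -/

/-- A set of at most `n` numbers below `N` is mapped injectively by the remainders for some modulus
`q ≤ 2 * k`. Otherwise every `q ≤ 2 * k` divides the product of all differences; then so does
`Nat.centralBinom k`, whose prime powers are at most `2 * k`, but the product is too small. -/
theorem exists_injOn_mod {N n k : ℕ} (hN : 0 < N) (hk : 4 ≤ k) (hkN : k * N ^ n ^ 2 ≤ 4 ^ k)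
    (S : Finset (Fin N)) (hS : S.card ≤ n) :
    ∃ q < 2 * k, Set.InjOn (fun u : Fin N => (u : ℕ) % (q + 1)) S := by
  by_contra! hcon
  let T := S.offDiag.filter fun p => p.1 < p.2
  let D := ∏ p ∈ T, ((p.2 : ℕ) - (p.1 : ℕ))
  have hpos : ∀ p ∈ T, 0 < (p.2 : ℕ) - (p.1 : ℕ) := fun p hp =>
    Nat.sub_pos_of_lt (Finset.mem_filter.1 hp).2
  have hD0 : 0 < D := Finset.prod_pos hpos
  have hdvd : ∀ q, 0 < q → q ≤ 2 * k → q ∣ D := by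
    intro q h0 hq
    have hc := hcon (q - 1) (by omega)
    rw [Nat.sub_add_cancel h0] at hc
    simp only [Set.InjOn] at hc
    push Not at hc
    obtain ⟨u, hu, v, hv, huv, hne⟩ := hc
    have main : ∀ u ∈ S, ∀ v ∈ S, (u : ℕ) % q = (v : ℕ) % q → u < v → q ∣ D := by
      intro u hu v hv huv hlt
      have hmem : (u, v) ∈ T := Finset.mem_filter.2 ⟨Finset.mem_offDiag.2 ⟨hu, hv, hlt.ne⟩, hlt⟩
      have : q ∣ (v : ℕ) - u := (Nat.modEq_iff_dvd' (le_of_lt hlt)).1 huv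
      exact this.trans
        (Finset.dvd_prod_of_mem (fun p : Fin N × Fin N => (p.2 : ℕ) - (p.1 : ℕ)) hmem)
    rcases lt_or_gt_of_ne hne with h | h
    · exact main u hu v hv huv h
    · exact main v hv u hu huv.symm h
  have hcb : k.centralBinom ∣ D := by
    rw [Nat.dvd_iff_prime_pow_dvd_dvd]
    intro p j hp hj
    apply hdvd _ (pow_pos hp.pos _)
    have h1 : j ≤ (k.centralBinom).factorization p :=
      (hp.pow_dvd_iff_le_factorization (Nat.centralBinom_ne_zero k)).1 hj
    refine (Nat.pow_le_pow_right hp.pos h1).trans ?_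
    rw [Nat.centralBinom_eq_two_mul_choose]
    exact Nat.pow_factorization_choose_le (by omega)
  have hDle : D ≤ N ^ n ^ 2 := by
    calc D ≤ ∏ _p ∈ T, N := Finset.prod_le_prod' fun p _ => by have := p.2.2; omega
      _ = N ^ T.card := by simp
      _ ≤ N ^ n ^ 2 := by
        apply Nat.pow_le_pow_right hN
        calc T.card ≤ S.offDiag.card := Finset.card_filter_le _ _
          _ ≤ S.card * S.card := by rw [Finset.offDiag_card]; omega
          _ ≤ n ^ 2 := by rw [sq]; exact Nat.mul_le_mul hS hS
  have h4 := Nat.four_pow_lt_mul_centralBinom k hk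
  have := Nat.le_of_dvd hD0 hcb
  have : k * k.centralBinom ≤ 4 ^ k := (Nat.mul_le_mul_left k (this.trans hDle)).trans hkN
  omega

/-! ### Compacting a graph with few vertices of positive degree -/

section Compaction

variable {N : ℕ} (M n : ℕ) (q : ℕ) (x : EdgeVar N → Bool)

/-- Two vertices of positive degree have the same remainder modulo `q + 1`. -/
def Collides : Prop :=
  ∃ u v : Fin N, u ≠ v ∧ (u : ℕ) % (q + 1) = (v : ℕ) % (q + 1) ∧
    u ∈ nonisolated (graphOf x) ∧ v ∈ nonisolated (graphOf x)

/-- The cell `c` is occupied: some vertex of positive degree has remainder `c` modulo `q + 1`. -/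
def CellOcc (c : Fin M) : Prop :=
  ∃ u ∈ nonisolated (graphOf x), (u : ℕ) % (q + 1) = c

/-- Some edge connects vertices with the remainders `c` and `c'` modulo `q + 1`. -/
def CellAdj (c c' : Fin M) : Prop :=
  ∃ u v : Fin N, (graphOf x).Adj u v ∧ (u : ℕ) % (q + 1) = c ∧ (v : ℕ) % (q + 1) = c'

/-- More than `n` cells are occupied. -/
def Overfull : Prop := n < countBelow (CellOcc M q x) M

open Classical in
/-- The graph on `n` vertices that arises by replacing a vertex of positive degree by the number of
occupied cells before its own cell. -/
noncomputable def compacted (e : EdgeVar n) : Bool :=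
  decide (∃ c c' : Fin M, CellAdj M q x c c' ∧
    (e.1.1 : ℕ) = countBelow (CellOcc M q x) c ∧ (e.1.2 : ℕ) = countBelow (CellOcc M q x) c')

variable {M n q x}

theorem countBelow_lt {o : Fin M → Prop} {c c' : Fin M} (h : c < c') (hc : o c) :
    countBelow o c < countBelow o c' := by
  classical
  have h1 := countBelow_succ o c c.2
  rw [if_pos hc] at h1
  have := countBelow_mono o (l := c + 1) (l' := c') (by simpa using h)
  omega

theorem countBelow_injOn {o : Fin M → Prop} {c c' : Fin M} (hc : o c) (hc' : o c')
    (h : countBelow o c = countBelow o c') : c = c' := by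
  rcases lt_trichotomy c c' with hl | hl | hl
  · exact absurd h (countBelow_lt hl hc).ne
  · exact hl
  · exact absurd h (countBelow_lt hl hc').ne'

theorem countBelow_lt_total {o : Fin M → Prop} {c : Fin M} (hc : o c) :
    countBelow o c < countBelow o M := by
  classical
  have h1 := countBelow_succ o c c.2
  rw [if_pos hc] at h1
  have := countBelow_mono o (l := c + 1) (l' := M) c.2
  omega

theorem padded_eq_compacted (hn : 0 < n) (hnN : n ≤ N) {f : (EdgeVar n → Bool) → Bool}
    (hf : Monotone f) (hf' : IsGraphProperty f) (hq : q < M) (hcol : ¬ Collides q x)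
    (hover : ¬ Overfull M n q x) : padded f N x = f (compacted M n q x) := by
  let o := CellOcc M q x
  let cell (u : Fin N) : Fin M := ⟨u % (q + 1), (Nat.mod_lt _ q.succ_pos).trans_le hq⟩
  have hocc : ∀ u ∈ nonisolated (graphOf x), o (cell u) := fun u hu => ⟨u, hu, rfl⟩
  have hlt : ∀ u ∈ nonisolated (graphOf x), countBelow o (cell u) < n := by
    intro u hu
    have := countBelow_lt_total (hocc u hu)
    have h2 : countBelow o M ≤ n := not_lt.1 hover
    omega
  apply padded_eq hnN hf hf' x
    (fun u => if h : countBelow o (cell u) < n then ⟨_, h⟩ else ⟨0, hn⟩)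
  · intro u hu v hv huv
    simp only [dif_pos (hlt u hu), dif_pos (hlt v hv), Fin.mk.injEq] at huv
    have := countBelow_injOn (hocc u hu) (hocc v hv) huv
    simp only [cell, Fin.mk.injEq] at this
    by_contra hne
    exact hcol ⟨u, v, hne, this, hu, hv⟩
  · intro e
    simp only [compacted, decide_eq_true_eq]
    constructor
    · rintro ⟨c, c', ⟨u, v, huv, hu, hv⟩, h1, h2⟩
      have h3 := hlt u (mem_nonisolated.2 ⟨_, huv⟩)
      have h4 := hlt v (mem_nonisolated.2 ⟨_, huv.symm⟩)
      have h5 : cell u = c := Fin.ext hu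
      have h6 : cell v = c' := Fin.ext hv
      refine ⟨u, v, huv, ?_, ?_⟩
      · rw [dif_pos h3]; apply Fin.ext; simp only [h5, h1, o]
      · rw [dif_pos h4]; apply Fin.ext; simp only [h6, h2, o]
    · rintro ⟨u, v, huv, h1, h2⟩
      rw [dif_pos (hlt u (mem_nonisolated.2 ⟨_, huv⟩))] at h1
      rw [dif_pos (hlt v (mem_nonisolated.2 ⟨_, huv.symm⟩))] at h2
      exact ⟨cell u, cell v, ⟨u, v, huv, rfl, rfl⟩, by rw [← h1], by rw [← h2]⟩

theorem padded_of_overfull {f : (EdgeVar n → Bool) → Bool} (hq : q < M)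
    (h : Overfull M n q x) : padded f N x = true := by
  classical
  rw [padded, decide_eq_true_eq]
  left
  refine lt_of_lt_of_le h ?_
  refine Finset.card_le_card_of_surjOn
    (fun u : Fin N => (⟨u % (q + 1), (Nat.mod_lt _ q.succ_pos).trans_le hq⟩ : Fin M)) ?_
  intro c hc
  simp only [Finset.coe_filter, Finset.mem_univ, true_and, Set.mem_ofPred_eq] at hc
  obtain ⟨u, hu, h⟩ := hc.2
  exact ⟨u, hu, Fin.ext h⟩

theorem countBelow_and_lt (o : Fin M → Prop) (l : ℕ) :
    countBelow (fun c : Fin M => (c : ℕ) < l ∧ o c) M = countBelow o l := by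
  classical
  simp [countBelow]

end Compaction

theorem isLiteral_adj {N : ℕ} {u v : Fin N} (h : u ≠ v) :
    IsLiteral fun x : EdgeVar N → Bool => (graphOf x).Adj u v := by
  rcases lt_or_gt_of_ne h with h | h
  · exact ⟨⟨(u, v), h⟩, false, by ext x; simp [graphOf_adj x h]⟩
  · exact ⟨⟨(v, u), h⟩, false, by
      ext x; rw [SimpleGraph.adj_comm]; simp [graphOf_adj x h]⟩

theorem card_subtype_prod_fin_le (N : ℕ) (P : Fin N × Fin N → Prop) :
    Nat.card {p // P p} ≤ N * N :=
  (Finite.card_subtype_le _).trans (by simp)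

theorem card_edgeVar_le (n : ℕ) : Nat.card (EdgeVar n) ≤ n * n :=
  card_subtype_prod_fin_le n _

theorem clog_pow_le (a k : ℕ) : Nat.clog 2 (a ^ k) ≤ k * Nat.clog 2 a := by
  rw [Nat.clog_le_iff_le_pow (by norm_num), mul_comm, pow_mul]
  exact Nat.pow_le_pow_left (Nat.le_pow_clog (by norm_num) a) k

/-- The occupied cells, the edges between cells and the collisions for all moduli up to `M`. -/
theorem comp_cells (N M : ℕ) :
    Comp andOr (2 * (2 + N + M * M + M * (M * M) + N * N + M)) 6 (11 + 7 * Nat.clog 2 N)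
      {p : (EdgeVar N → Bool) → Prop | p = (fun _ => True) ∨ p = (fun _ => False) ∨
        (∃ (q c : Fin M), p = (fun x => CellOcc M q x c) ∨ p = fun x => ¬ CellOcc M q x c) ∨
        (∃ (q c c' : Fin M), p = fun x => CellAdj M q x c c') ∨
        ∃ q : Fin M, p = (fun x => Collides q x) ∨ p = fun x => ¬ Collides q x} := by
  have hlit : ∀ {F : Set ((EdgeVar N → Bool) → Prop)} {s d e : ℕ}, Comp andOr s d e F →
      Comp andOr s d e (F ∪ {p | ∃ u v : Fin N, u ≠ v ∧ p = fun x => (graphOf x).Adj u v}) := by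
    rintro F s d e ⟨L, h1, h2, h3, h4⟩
    refine ⟨L, h1, h2, h3, ?_⟩
    rintro p (hp | ⟨u, v, huv, rfl⟩)
    · exact h4 p hp
    · exact Or.inl (isLiteral_adj huv)
  have hand : GateOp.and ∈ andOr := by simp [andOr]
  have hor : GateOp.or ∈ andOr := by simp [andOr]
  have h0 := hlit ((comp_literals (ι := EdgeVar N) andOr).constants subset_rfl)
  have h1 := h0.or_layer hor (κ := Fin N) (J := fun u => {v : Fin N // u ≠ v}) N
    (fun u v x => (graphOf x).Adj u v.1)
    (fun u => (Finite.card_subtype_le _).trans (by simp))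
    (fun u v => Or.inr ⟨u, v.1, v.2, rfl⟩)
  have h2 := h1.or_layer hor (κ := Fin M × Fin M)
    (J := fun k => {p : Fin N × Fin N // p.1 ≠ p.2 ∧ (p.1 : ℕ) % ((k.1 : ℕ) + 1) = k.2}) (N * N)
    (fun k p x => (graphOf x).Adj p.1.1 p.1.2) (fun k => card_subtype_prod_fin_le N _)
    (fun k p => Or.inl (Or.inr ⟨_, _, p.2.1, rfl⟩))
  have h3 := h2.or_layer hor (κ := Fin M × Fin M × Fin M)
    (J := fun k => {p : Fin N × Fin N // p.1 ≠ p.2 ∧ (p.1 : ℕ) % ((k.1 : ℕ) + 1) = k.2.1 ∧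
      (p.2 : ℕ) % ((k.1 : ℕ) + 1) = k.2.2}) (N * N)
    (fun k p x => (graphOf x).Adj p.1.1 p.1.2) (fun k => card_subtype_prod_fin_le N _)
    (fun k p => Or.inl (Or.inl (Or.inr ⟨_, _, p.2.1, rfl⟩)))
  have h4 := h3.and_layer hand (κ := Fin N × Fin N) (J := fun _ => Bool) 2
    (fun k b x => ∃ v : {v : Fin N // (bif b then k.1 else k.2) ≠ v},
      (graphOf x).Adj (bif b then k.1 else k.2) v.1) (fun k => by simp)
    (fun k b => Or.inl (Or.inl (Or.inr ⟨_, rfl⟩)))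
  have h5 := h4.or_layer hor (κ := Fin M)
    (J := fun q => {p : Fin N × Fin N // p.1 ≠ p.2 ∧
      (p.1 : ℕ) % ((q : ℕ) + 1) = (p.2 : ℕ) % ((q : ℕ) + 1)}) (N * N)
    (fun q p x => ∀ b, ∃ v : {v : Fin N // (bif b then p.1.1 else p.1.2) ≠ v},
      (graphOf x).Adj (bif b then p.1.1 else p.1.2) v.1) (fun k => card_subtype_prod_fin_le N _)
    (fun q p => Or.inr ⟨p.1, rfl⟩)
  have h6 := h5.dual
  have hnon : ∀ (x : EdgeVar N → Bool) (u : Fin N), u ∈ nonisolated (graphOf x) ↔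
      ∃ v : {v : Fin N // u ≠ v}, (graphOf x).Adj u v.1 := by
    intro x u
    rw [mem_nonisolated]
    exact ⟨fun ⟨v, hv⟩ => ⟨⟨v, hv.ne⟩, hv⟩, fun ⟨v, hv⟩ => ⟨v.1, hv⟩⟩
  have hclog := clog_pow_le N 2
  rw [sq] at hclog
  have hclog2 : Nat.clog 2 2 = 1 := by decide
  refine h6.mono subset_rfl (by simp) le_rfl (by omega) ?_
  have hocc : ∀ q c : Fin M, (fun x => CellOcc M q x c) ∈ Set.range fun (k : Fin M × Fin M) x =>
      ∃ p : {p : Fin N × Fin N // p.1 ≠ p.2 ∧ (p.1 : ℕ) % ((k.1 : ℕ) + 1) = k.2},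
        (graphOf x).Adj p.1.1 p.1.2 := by
    intro q c
    refine ⟨(q, c), ?_⟩
    ext x
    constructor
    · rintro ⟨⟨p, h1, h2⟩, h3⟩
      exact ⟨p.1, mem_nonisolated.2 ⟨_, h3⟩, h2⟩
    · rintro ⟨u, hu, h⟩
      obtain ⟨v, hv⟩ := mem_nonisolated.1 hu
      exact ⟨⟨(u, v), hv.ne, h⟩, hv⟩
  have hcol : ∀ q : Fin M, (fun x : EdgeVar N → Bool => Collides q x) ∈
      Set.range fun (q : Fin M) (x : EdgeVar N → Bool) => ∃ p : {p : Fin N × Fin N // p.1 ≠ p.2 ∧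
        (p.1 : ℕ) % ((q : ℕ) + 1) = (p.2 : ℕ) % ((q : ℕ) + 1)},
        ∀ b, ∃ v : {v : Fin N // (bif b then p.1.1 else p.1.2) ≠ v},
          (graphOf x).Adj (bif b then p.1.1 else p.1.2) v.1 := by
    intro q
    refine ⟨q, ?_⟩
    ext x
    simp only [← hnon, Bool.forall_bool, cond_true, cond_false]
    constructor
    · rintro ⟨⟨p, h1, h2⟩, h3, h4⟩
      exact ⟨p.1, p.2, h1, h2, h4, h3⟩
    · rintro ⟨u, v, h1, h2, h3, h4⟩
      exact ⟨⟨(u, v), h1, h2⟩, h4, h3⟩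
  rintro p (rfl | rfl | ⟨q, c, rfl | rfl⟩ | ⟨q, c, c', rfl⟩ | ⟨q, rfl | rfl⟩)
  · iterate 7 left
    right; simp
  · iterate 7 left
    right; simp
  · iterate 4 left
    right; exact hocc q c
  · right
    refine ⟨_, ?_, rfl⟩
    iterate 3 left
    right; exact hocc q c
  · iterate 3 left
    right
    refine ⟨(q, c, c'), ?_⟩
    ext x
    constructor
    · rintro ⟨⟨p, h1, h2⟩, h3⟩
      exact ⟨p.1, p.2, h3, h2⟩
    · rintro ⟨u, v, huv, h⟩
      exact ⟨⟨(u, v), huv.ne, h⟩, huv⟩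
  · left; right; exact hcol q
  · right; exact ⟨_, Or.inr (hcol q), rfl⟩

/-- The bits of the compacted graphs for all moduli up to `M`. The exponent `r ^ t` is the length
of the runs of the counting automaton. -/
theorem comp_compacted (N M n r t : ℕ) (hM : 0 < M) (hn : 0 < n) (hrt : M ≤ r ^ t) :
    Comp andOr (16 * N ^ 2 + (18 + 4 * t) * ((M + 1) * (n + 1)) ^ (r + 3)) (9 + 2 * t)
      (17 + 7 * Nat.clog 2 N + 3 * Nat.clog 2 ((M + 1) * (n + 1)) +
        t * (Nat.clog 2 r + (r + 1) * Nat.clog 2 ((M + 1) * (n + 1)) + 2))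
      {p : (EdgeVar N → Bool) → Prop |
        (∃ q : Fin M, p = (fun x => Collides q x) ∨ p = (fun x => ¬ Collides q x) ∨
          p = (fun x => Overfull M n q x)) ∨
        p = (fun _ => True) ∨ p = (fun _ => False) ∨
        ∃ (q : Fin M) (e : EdgeVar n) (b : Bool), p = fun x => compacted M n q x e = b} := by
  classical
  set P := (M + 1) * (n + 1) with hP
  have hand : GateOp.and ∈ andOr := by simp [andOr]
  have hor : GateOp.or ∈ andOr := by simp [andOr]
  have h1 := (comp_cells N M).count subset_rfl (κ := Fin M × Fin (M + 1)) n r t hrt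
    (fun k x c => (c : ℕ) < k.2 ∧ CellOcc M k.1 x c) (by
      intro k c
      by_cases h : (c : ℕ) < k.2
      · exact Or.inr (Or.inr (Or.inl ⟨k.1, c, Or.inl (by simp [h])⟩))
      · exact Or.inr (Or.inl (by simp [h]))) (by
      intro k c
      by_cases h : (c : ℕ) < k.2
      · exact Or.inr (Or.inr (Or.inl ⟨k.1, c, Or.inr (by simp [h])⟩))
      · exact Or.inl (by simp [h])) (Or.inl rfl) (Or.inr (Or.inl rfl))
  simp only [countBelow_and_lt, ← hP] at h1
  -- the gates for a pair of cells that are adjacent and have given ranks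
  have h2 := h1.layer (κ := Fin M × EdgeVar n × Fin M × Fin M) 3
    (G := fun k x => CellAdj M k.1 x k.2.2.1 k.2.2.2 ∧
      (k.2.1.1.1 : ℕ) = countBelow (CellOcc M k.1 x) k.2.2.1 ∧
      (k.2.1.1.2 : ℕ) = countBelow (CellOcc M k.1 x) k.2.2.2) (by
    rintro ⟨q, e, c, c'⟩
    refine ⟨.and, hand, [fun x => CellAdj M q x c c',
      fun x => (e.1.1 : ℕ) = countBelow (CellOcc M q x) c,
      fun x => (e.1.2 : ℕ) = countBelow (CellOcc M q x) c'], by simp, ?_, fun x => ?_⟩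
    · intro p hp
      simp only [List.mem_cons, List.not_mem_nil, or_false] at hp
      rcases hp with rfl | rfl | rfl
      · exact Or.inl (Or.inr (Or.inr (Or.inr (Or.inl ⟨q, c, c', rfl⟩))))
      · exact Or.inr ⟨(q, c.castSucc), e.1.1.castSucc, rfl⟩
      · exact Or.inr ⟨(q, c'.castSucc), e.1.2.castSucc, rfl⟩
    · simp [gateSem, GateOp.eval])
  have h3 := h2.or_layer hor (κ := Fin M × EdgeVar n) (J := fun _ => Fin M × Fin M) (M * M)
    (fun k j x => CellAdj M k.1 x j.1 j.2 ∧
      (k.2.1.1 : ℕ) = countBelow (CellOcc M k.1 x) j.1 ∧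
      (k.2.1.2 : ℕ) = countBelow (CellOcc M k.1 x) j.2) (fun _ => by simp)
    (fun k j => Or.inr ⟨(k.1, k.2, j.1, j.2), rfl⟩)
  have h4 := h3.dual
  have h5 := h4.and_layer hand (κ := Fin M) (J := fun _ => Fin (n + 1)) (n + 1)
    (fun q a x => ¬ (a : ℕ) = countBelow (CellOcc M q x) M) (by simp) (by
      intro q a
      refine Or.inr ⟨_, Or.inl (Or.inl (Or.inr ⟨(q, Fin.last M), a, rfl⟩)), rfl⟩)
  have hMP : M + 1 ≤ P := Nat.le_mul_of_pos_right _ (by omega)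
  have hnP : n + 1 ≤ P := Nat.le_mul_of_pos_left _ (by omega)
  refine h5.mono subset_rfl ?_ (by omega) ?_ ?_
  · have hcE := card_edgeVar_le n
    simp only [Nat.card_prod, Nat.card_fin]
    have b1 : 2 + N + M * M + M * (M * M) + N * N + M ≤ 2 + 2 * N ^ 2 + 3 * P ^ 3 := by
      have e1 : N ≤ N ^ 2 := Nat.le_self_pow (by norm_num) N
      have e2 : M * (M * M) ≤ P ^ 3 := by
        calc M * (M * M) = M ^ 3 := by ring
          _ ≤ P ^ 3 := Nat.pow_le_pow_left (by omega) 3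
      have e3 : M * M ≤ P ^ 3 := le_trans (Nat.le_mul_of_pos_left _ hM) e2
      have e4 : M ≤ P ^ 3 := le_trans (Nat.le_mul_of_pos_left _ hM) e3
      nlinarith
    have b2 : M * (M + 1) * (P ^ (r + 1) + P ^ 2) ≤ 2 * P ^ (r + 3) := by
      have e1 : M * (M + 1) ≤ P ^ 2 := by
        rw [sq]; exact Nat.mul_le_mul (by omega) hMP
      have hr : r ≠ 0 ∨ r = 0 := by tauto
      rcases hr with hr | rfl
      · have e2 : P ^ 2 ≤ P ^ (r + 1) := Nat.pow_le_pow_right (by omega) (by omega)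
        calc M * (M + 1) * (P ^ (r + 1) + P ^ 2) ≤ P ^ 2 * (P ^ (r + 1) + P ^ (r + 1)) := by gcongr
          _ = 2 * P ^ (r + 3) := by ring
      · have hM1 : M = 1 := by
          rcases Nat.eq_zero_or_pos t with rfl | ht
          · simp at hrt; omega
          · rw [zero_pow ht.ne'] at hrt; omega
        have hP4 : 4 ≤ P := by rw [hP, hM1]; omega
        rw [hM1]
        simp only [zero_add, pow_one]
        nlinarith [sq_nonneg (P : ℤ), Nat.zero_le (P ^ 2)]
    have b3 : M * (Nat.card (EdgeVar n) * (M * M)) + M * Nat.card (EdgeVar n) ≤ 2 * P ^ 3 := by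
      have e1 : M * n ≤ P := Nat.mul_le_mul (by omega) (by omega)
      have e2 : M * (Nat.card (EdgeVar n) * (M * M)) ≤ P ^ 3 := by
        calc M * (Nat.card (EdgeVar n) * (M * M)) ≤ M * ((n * n) * (M * M)) := by gcongr
          _ = (M * n) * (M * n) * M := by ring
          _ ≤ P * P * P := by gcongr; omega
          _ = P ^ 3 := by ring
      have e3 : M * Nat.card (EdgeVar n) ≤ M * (Nat.card (EdgeVar n) * (M * M)) := by
        gcongr
        exact Nat.le_mul_of_pos_right _ (by positivity)
      omega
    have b4 : P ^ 3 ≤ P ^ (r + 3) := Nat.pow_le_pow_right (by omega) (by omega)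
    have b5 : M ≤ P ^ 3 := le_trans (by omega) (Nat.le_self_pow (by norm_num) P)
    have b6 : t * (M * (M + 1) * (P ^ (r + 1) + P ^ 2)) ≤ t * (2 * P ^ (r + 3)) :=
      Nat.mul_le_mul_left t b2
    have b7 : 64 ≤ P ^ 3 := by
      have : 4 ≤ P := by rw [hP]; nlinarith
      calc 64 = 4 ^ 3 := by norm_num
        _ ≤ P ^ 3 := Nat.pow_le_pow_left this 3
    calc _ ≤ 2 * (2 * (2 + 2 * N ^ 2 + 3 * P ^ 3) + t * (2 * P ^ (r + 3)) + 2 * P ^ 3) + P ^ 3 := by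
          omega
      _ ≤ 16 * N ^ 2 + (18 + 4 * t) * P ^ (r + 3) := by linarith [Nat.zero_le (N ^ 2)]
  · have c1 := clog_pow_le P (r + 1)
    have c2 := clog_pow_le M 2
    rw [sq] at c2
    have c3 : Nat.clog 2 M ≤ Nat.clog 2 P := Nat.clog_mono_right 2 (by omega)
    have c4 : Nat.clog 2 (n + 1) ≤ Nat.clog 2 P := Nat.clog_mono_right 2 hnP
    have c5 : Nat.clog 2 3 = 2 := by decide
    have c6 : t * (Nat.clog 2 r + Nat.clog 2 (P ^ (r + 1)) + 2) ≤
        t * (Nat.clog 2 r + (r + 1) * Nat.clog 2 P + 2) := by gcongr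
    omega
  · have hcomp : ∀ (q : Fin M) (e : EdgeVar n) (x : EdgeVar N → Bool),
        compacted M n q x e = true ↔ ∃ j : Fin M × Fin M, CellAdj M q x j.1 j.2 ∧
          (e.1.1 : ℕ) = countBelow (CellOcc M q x) j.1 ∧
          (e.1.2 : ℕ) = countBelow (CellOcc M q x) j.2 := by
      intro q e x
      simp only [compacted, decide_eq_true_eq, Prod.exists]
    rintro p (⟨q, rfl | rfl | rfl⟩ | rfl | rfl | ⟨q, e, rfl | rfl, rfl⟩)
    · exact Or.inl (Or.inl (Or.inl (Or.inl (Or.inl (Or.inr (Or.inr (Or.inr (Or.inr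
        ⟨q, Or.inl rfl⟩))))))))
    · exact Or.inl (Or.inl (Or.inl (Or.inl (Or.inl (Or.inr (Or.inr (Or.inr (Or.inr
        ⟨q, Or.inr rfl⟩))))))))
    · right
      refine ⟨q, ?_⟩
      ext x
      simp only [Overfull]
      constructor
      · intro h
        by_contra hc
        exact h ⟨_, Nat.lt_succ_of_le (not_lt.1 hc)⟩ rfl
      · intro h a ha
        have := a.2
        omega
    · exact Or.inl (Or.inl (Or.inl (Or.inl (Or.inl (Or.inl rfl)))))
    · exact Or.inl (Or.inl (Or.inl (Or.inl (Or.inl (Or.inr (Or.inl rfl))))))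
    · refine Or.inl (Or.inr ⟨_, Or.inr ⟨(q, e), rfl⟩, ?_⟩)
      ext x
      simp only [← hcomp, Bool.not_eq_true]
    · refine Or.inl (Or.inl (Or.inr ⟨(q, e), ?_⟩))
      ext x
      simp only [← hcomp]

/-- From the values of `f` on all compacted graphs to the padded property: if every modulus has a
collision, there are more than `n` vertices of positive degree; otherwise a modulus without
collision gives the correct value. -/
theorem Comp.padded {N n k : ℕ} (hN : 0 < N) (hn : 0 < n) (hnN : n ≤ N) (hk : 4 ≤ k)
    (hkN : k * N ^ n ^ 2 ≤ 4 ^ k) {f : (EdgeVar n → Bool) → Bool}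
    (hf : Monotone f) (hf' : IsGraphProperty f)
    {U : Set GateOp} (hU : andOr ⊆ U) {s d e : ℕ} {F : Set ((EdgeVar N → Bool) → Prop)}
    (h : Comp U s d e F)
    (hcol : ∀ q : Fin (2 * k), (fun x => Collides q x) ∈ F ∧ (fun x => ¬ Collides q x) ∈ F)
    (hover : ∀ q : Fin (2 * k), (fun x => Overfull (2 * k) n q x) ∈ F)
    (hval : ∀ q : Fin (2 * k), (fun x => f (compacted (2 * k) n q x) = true) ∈ F) :
    Comp U (s + (4 * k + 2)) (d + 4) (e + 2 * Nat.clog 2 (2 * k + 1) + 6)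
      {fun x => GraphPadding.padded f N x = true} := by
  have hand : GateOp.and ∈ U := hU (by simp [andOr])
  have hor : GateOp.or ∈ U := hU (by simp [andOr])
  have hcl : Nat.clog 2 2 = 1 := by decide
  have hcl' : Nat.clog 2 (2 * k) ≤ Nat.clog 2 (2 * k + 1) := Nat.clog_mono_right 2 (by omega)
  have h1 := h.layer (κ := Fin (2 * k)) 2
    (G := fun q x => Overfull (2 * k) n q x ∨ f (compacted (2 * k) n q x) = true) (by
      intro q
      refine ⟨.or, hor, [fun x => Overfull (2 * k) n q x,
        fun x => f (compacted (2 * k) n q x) = true], by simp, ?_, fun x => ?_⟩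
      · simpa using ⟨hover q, hval q⟩
      · simp [gateSem, GateOp.eval])
  have h2 := h1.layer (κ := Fin (2 * k)) 2
    (G := fun q x => ¬ Collides q x ∧
      (Overfull (2 * k) n q x ∨ f (compacted (2 * k) n q x) = true)) (by
      intro q
      refine ⟨.and, hand, [fun x => ¬ Collides q x,
        fun x => Overfull (2 * k) n q x ∨ f (compacted (2 * k) n q x) = true], by simp, ?_,
        fun x => ?_⟩
      · intro p hp
        simp only [List.mem_cons, List.not_mem_nil, or_false] at hp
        rcases hp with rfl | rfl
        · exact Or.inl (hcol q).2
        · exact Or.inr ⟨q, rfl⟩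
      · simp [gateSem, GateOp.eval])
  have h3 := h2.and_layer hand (κ := Unit) (J := fun _ => Fin (2 * k)) (2 * k)
    (fun _ q x => Collides q x) (by simp) (fun _ q => Or.inl (Or.inl (hcol q).1))
  have h4 := h3.or_layer hor (κ := Unit) (J := fun _ => Option (Fin (2 * k))) (2 * k + 1)
    (fun _ q x => match q with
      | none => ∀ q : Fin (2 * k), Collides q x
      | some q => ¬ Collides q x ∧
        (Overfull (2 * k) n q x ∨ f (compacted (2 * k) n q x) = true)) (by simp) (by
      rintro - (_ | q)
      · exact Or.inr ⟨(), rfl⟩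
      · exact Or.inl (Or.inr ⟨q, rfl⟩))
  refine h4.mono subset_rfl (by simp; omega) le_rfl (by omega) ?_
  rintro p rfl
  refine Or.inr ⟨(), ?_⟩
  ext x
  simp only [Option.exists]
  constructor
  · rintro (hall | ⟨q, hq, h | h⟩)
    · -- all moduli have collisions, so the hashing lemma does not apply
      by_contra hpad
      have hcard : (nonisolated (graphOf x)).card ≤ n := by
        by_contra hc
        refine hpad ?_
        classical
        rw [GraphPadding.padded, decide_eq_true_eq]
        exact Or.inl (not_le.1 hc)
      obtain ⟨q, hq, hinj⟩ := exists_injOn_mod hN hk hkN _ hcard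
      obtain ⟨u, v, hne, huv, hu, hv⟩ := hall ⟨q, hq⟩
      exact hne (hinj hu hv huv)
    · exact padded_of_overfull q.2 h
    · by_cases ho : Overfull (2 * k) n q x
      · exact padded_of_overfull q.2 ho
      · rw [padded_eq_compacted hn hnN hf hf' q.2 hq ho]
        exact h
  · intro h
    by_cases hall : ∀ q : Fin (2 * k), Collides q x
    · exact Or.inl hall
    · push Not at hall
      obtain ⟨q, hq⟩ := hall
      refine Or.inr ⟨q, hq, ?_⟩
      by_cases ho : Overfull (2 * k) n q x
      · exact Or.inl ho
      · rw [padded_eq_compacted hn hnN hf hf' q.2 hq ho] at h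
        exact Or.inr h

/-! ### Configuration graphs of logspace machines -/

section Machine

variable (M : NTM)

instance finite_headMove : Finite HeadMove :=
  Finite.of_injective (fun m : HeadMove => match m with
    | .left => (0 : Fin 3)
    | .stay => 1
    | .right => 2) (by rintro (_ | _ | _) (_ | _ | _) h <;> simp_all)

instance finite_action : Finite (TMAction M.State M.Symbol) := by
  have := M.finiteState
  have := M.finiteSymbol
  refine Finite.of_injective
    (fun a : TMAction M.State M.Symbol => (a.newState, a.write, a.inputMove, a.workMove)) ?_
  rintro ⟨_, _, _, _⟩ ⟨_, _, _, _⟩ h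
  simp_all

/-- The configurations on words of length `len` that use only the cells `0, …, S` of the work
tape. -/
abbrev BoundedConfig (len S : ℕ) : Type :=
  {c : M.Config // c.inputPos ≤ len + 1 ∧ c.workPos ≤ S ∧ ∀ p, S < p → c.tape p = M.blank}

theorem boundedConfig_finite_card (len S : ℕ) : Finite (BoundedConfig M len S) ∧
    Nat.card (BoundedConfig M len S) ≤
      Nat.card M.State * ((len + 2) * ((S + 1) * Nat.card M.Symbol ^ (S + 1))) := by
  have := M.finiteState
  have := M.finiteSymbol
  let code (c : BoundedConfig M len S) :
      M.State × Fin (len + 2) × Fin (S + 1) × (Fin (S + 1) → M.Symbol) :=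
    (c.1.state, ⟨c.1.inputPos, by have := c.2.1; omega⟩, ⟨c.1.workPos, by have := c.2.2.1; omega⟩,
      fun p => c.1.tape p)
  have hinj : Function.Injective code := by
    rintro ⟨⟨s, i, p, t⟩, h⟩ ⟨⟨s', i', p', t'⟩, h'⟩ hc
    simp only [code, Prod.mk.injEq, Fin.mk.injEq] at hc
    obtain ⟨rfl, rfl, rfl, ht⟩ := hc
    have : t = t' := by
      ext j
      by_cases hj : S < j
      · exact (h.2.2 j hj).trans (h'.2.2 j hj).symm
      · exact congrFun ht ⟨j, by omega⟩
    subst this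
    rfl
  refine ⟨Finite.of_injective code hinj, ?_⟩
  have := Nat.card_le_card_of_injective code hinj
  simpa [Nat.card_prod, Nat.card_fun] using this

instance finite_boundedConfig (len S : ℕ) : Finite (BoundedConfig M len S) :=
  (boundedConfig_finite_card M len S).1

open Classical in
/-- The numbers of actions between bounded configurations on the word `w`. The additional node
`none` has a loop, and it is reached in one step from the accepting halting configurations. -/
noncomputable def configMatrix (w : List Bool) (len S : ℕ) :
    Matrix (Option (BoundedConfig M len S)) (Option (BoundedConfig M len S)) ℕ
  | some c, some c' => {a | a ∈ M.actions w c.1 ∧ M.next w c.1 a = c'.1}.ncard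
  | some c, none => if M.actions w c.1 = ∅ ∧ c.1.state ∈ M.accept then 1 else 0
  | none, some _ => 0
  | none, none => 1

/-- The computation paths of length less than `l` from `c` to an accepting halting
configuration. -/
def acceptingFrom (w : List Bool) (c : M.Config) (l : ℕ) :
    Set (List (TMAction M.State M.Symbol)) :=
  {p | p.length < l ∧ ∃ c', M.Run w c p c' ∧ M.actions w c' = ∅ ∧ c'.state ∈ M.accept}

theorem ncard_list_set {α : Type*} [Fintype α] (T : Set (List α)) (hT : T.Finite)
    [Decidable ([] ∈ T)] :
    T.ncard = (if [] ∈ T then 1 else 0) + ∑ a, {l | a :: l ∈ T}.ncard := by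
  classical
  rw [Set.ncard_eq_toFinset_card T hT,
    Finset.card_eq_sum_card_fiberwise (t := Finset.univ) (f := List.head?) (by simp),
    Fintype.sum_option]
  congr 1
  · split_ifs with h
    · rw [Finset.card_eq_one]
      refine ⟨[], ?_⟩
      ext l
      simp only [Finset.mem_filter, Set.Finite.mem_toFinset, List.head?_eq_none_iff,
        Finset.mem_singleton]
      exact ⟨fun hl => hl.2, fun hl => ⟨hl ▸ h, hl⟩⟩
    · rw [Finset.card_eq_zero, Finset.filter_eq_empty_iff]
      intro l hl hl'
      rw [List.head?_eq_none_iff] at hl'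
      exact h (by simpa [hl'] using hl)
  · refine Finset.sum_congr rfl fun a _ => ?_
    rw [← Set.ncard_image_of_injective _ (List.cons_injective (a := a)), ← Set.ncard_coe_finset]
    congr 1
    ext l
    simp only [Finset.coe_filter, Set.Finite.mem_toFinset, Set.mem_ofPred_eq, Set.mem_image]
    constructor
    · rintro ⟨h1, h2⟩
      obtain ⟨l', rfl⟩ := List.head?_eq_some_iff.1 h2
      exact ⟨l', h1, rfl⟩
    · rintro ⟨l', h, rfl⟩
      exact ⟨h, rfl⟩

variable {M}

theorem acceptingFrom_finite (w : List Bool) (c : M.Config) (l : ℕ) :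
    (acceptingFrom M w c l).Finite :=
  (List.finite_length_lt (TMAction M.State M.Symbol) l).subset fun _ h => h.1

theorem mem_boundedConfig_next {w : List Bool} {len S : ℕ} (hw : w.length = len) {c : M.Config}
    (hc : ∀ p, S < p → c.tape p = M.blank) (hS : ∀ p c', M.Run w c p c' → c'.workPos ≤ S)
    {a : TMAction M.State M.Symbol} (ha : a ∈ M.actions w c) :
    (M.next w c a).inputPos ≤ len + 1 ∧ (M.next w c a).workPos ≤ S ∧
      ∀ p, S < p → (M.next w c a).tape p = M.blank := by
  refine ⟨?_, hS _ _ (.cons ha (.nil _)), fun p hp => ?_⟩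
  · simp only [NTM.next, hw]
    exact min_le_right _ _
  · have := hS _ _ (.nil _)
    simp only [NTM.next]
    rw [Function.update_of_ne (by omega)]
    exact hc p hp

/-- The entries of the powers of the configuration matrix count accepting computation paths. -/
theorem configMatrix_pow {len S : ℕ} [Fintype (Option (BoundedConfig M len S))]
    [DecidableEq (Option (BoundedConfig M len S))] {w : List Bool} (hw : w.length = len) (l : ℕ)
    (c : BoundedConfig M len S) (hS : ∀ p c', M.Run w c.1 p c' → c'.workPos ≤ S) :
    (configMatrix M w len S ^ l) (some c) none = (acceptingFrom M w c.1 l).ncard := by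
  classical
  have := Fintype.ofFinite (TMAction M.State M.Symbol)
  have := Fintype.ofFinite (BoundedConfig M len S)
  have hnone : ∀ l, (configMatrix M w len S ^ l) none none = 1 := by
    intro l
    induction l with
    | zero => simp
    | succ l ih =>
      rw [pow_succ', Matrix.mul_apply, Finset.sum_eq_single none]
      · rw [ih]; rfl
      · rintro (_ | b) - hb
        · exact absurd rfl hb
        · exact zero_mul _
      · simp
  induction l generalizing c with
  | zero =>
    have : acceptingFrom M w c.1 0 = ∅ := by
      ext p; simp [acceptingFrom]
    rw [this, Set.ncard_empty]
    simp
  | succ l ih =>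
    have hsum : ∀ g : Option (BoundedConfig M len S) → ℕ,
        ∑ v, g v = g none + ∑ b, g (some b) := by
      intro g
      rw [← Fintype.sum_option]
      exact Finset.sum_congr (by ext; simp) fun _ _ => rfl
    rw [pow_succ', Matrix.mul_apply, hsum, hnone, mul_one,
      ncard_list_set _ (acceptingFrom_finite w c.1 (l + 1))]
    congr 1
    · have : [] ∈ acceptingFrom M w c.1 (l + 1) ↔
          M.actions w c.1 = ∅ ∧ c.1.state ∈ M.accept := by
        constructor
        · rintro ⟨-, c', hrun, h⟩
          cases hrun
          exact h
        · exact fun h => ⟨by simp, c.1, .nil _, h⟩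
      simp only [configMatrix, this]
    · have hentry : ∀ b, configMatrix M w len S (some c) (some b) =
          ∑ a, if a ∈ M.actions w c.1 ∧ M.next w c.1 a = b.1 then 1 else 0 := by
        intro b
        simp only [configMatrix]
        rw [Set.ncard_eq_toFinset_card', Finset.sum_boole]
        congr 1
        ext a
        simp
      simp only [hentry, Finset.sum_mul]
      rw [Finset.sum_comm]
      refine Finset.sum_congr rfl fun a _ => ?_
      by_cases ha : a ∈ M.actions w c.1
      · have hb := mem_boundedConfig_next hw c.2.2.2 hS ha
        rw [Finset.sum_eq_single ⟨M.next w c.1 a, hb⟩]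
        · rw [if_pos ⟨ha, rfl⟩, one_mul, ih _ fun p c' h => hS _ _ (.cons ha h)]
          congr 1
          ext p
          constructor
          · rintro ⟨h1, c', h2, h3⟩
            exact ⟨by simpa using h1, c', .cons ha h2, h3⟩
          · rintro ⟨h1, c', h2, h3⟩
            cases h2 with
            | cons _ h2 => exact ⟨by simpa using h1, c', h2, h3⟩
        · intro b _ hne
          rw [if_neg, zero_mul]
          rintro ⟨-, h⟩
          exact hne (Subtype.ext h.symm)
        · simp
      · have : {p | a :: p ∈ acceptingFrom M w c.1 (l + 1)} = ∅ := by
          ext p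
          simp only [Set.mem_ofPred_eq, Set.mem_empty_iff_false, iff_false]
          rintro ⟨-, c', h, -⟩
          cases h with
          | cons h' _ => exact ha h'
        simp [this, ha]

theorem acceptingPaths_eq {w : List Bool} {T : ℕ}
    (hT : ∀ l c, M.Run w M.init l c → l.length < T) :
    M.acceptingPaths w = acceptingFrom M w M.init T := by
  ext p
  constructor
  · rintro ⟨c, h1, h2⟩
    exact ⟨hT _ _ h1, c, h1, h2⟩
  · rintro ⟨-, c, h⟩
    exact ⟨c, h⟩

end Machine

section MachineCircuits

variable {ι : Type} {U : Set GateOp} {s d e : ℕ} {F : Set ((ι → Bool) → Prop)}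

theorem graphWord_length {n : ℕ} (y : EdgeVar n → Bool) :
    (graphWord y).length = (edgeList n).length := by
  simp [graphWord]

/-- Every property of an input symbol is a constant or a literal. -/
theorem inputAt_mem {n : ℕ} (Y : (ι → Bool) → EdgeVar n → Bool)
    (hT : (fun _ => True) ∈ F) (hF : (fun _ => False) ∈ F)
    (hY : ∀ i b, (fun x => Y x i = b) ∈ F) (Q : InputSym → Prop) (p : ℕ) :
    (fun x => Q (NTM.inputAt (graphWord (Y x)) p)) ∈ F := by
  have hconst : ∀ P : Prop, (fun _ : ι → Bool => P) ∈ F := by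
    intro P
    by_cases h : P
    · simpa [h] using hT
    · simpa [h] using hF
  rcases p with _ | p
  · exact hconst (Q .leftEnd)
  · rcases hp : (edgeList n)[p]? with _ | i
    · simpa [NTM.inputAt, graphWord, hp] using hconst (Q .rightEnd)
    · have : (fun x => Q (NTM.inputAt (graphWord (Y x)) (p + 1))) =
          fun x => Q (.bit (Y x i)) := by
        ext x
        simp [NTM.inputAt, graphWord, hp]
      rw [this]
      by_cases h1 : Q (.bit true) <;> by_cases h0 : Q (.bit false)
      · convert hT using 1
        ext x
        cases h : Y x i <;> simp [h0, h1]
      · convert hY i true using 1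
        ext x
        cases h : Y x i <;> simp [h0, h1]
      · convert hY i false using 1
        ext x
        cases h : Y x i <;> simp [h0, h1]
      · convert hF using 1
        ext x
        cases h : Y x i <;> simp [h0, h1]

/-- The accepting paths of a machine on several computed graphs are counted, with respect to `φ`,
in constant depth. The exponent `r ^ t` has to exceed the running time. -/
theorem Comp.machine (h : Comp U s d e F) (hand : GateOp.and ∈ U) {φ : ℕ → Prop} {op : GateOp}
    (hφ : IsCounting φ op) (hop : op ∈ U) {κ : Type} [Finite κ] {n : ℕ}
    (Y : κ → (ι → Bool) → EdgeVar n → Bool) (hT : (fun _ => True) ∈ F) (hF : (fun _ => False) ∈ F)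
    (hY : ∀ k i b, (fun x => Y k x i = b) ∈ F) (M : NTM) (r t S : ℕ)
    (hS : ∀ (y : EdgeVar n → Bool) l c, M.Run (graphWord y) M.init l c → c.workPos ≤ S)
    (htime : ∀ (y : EdgeVar n → Bool) l c, M.Run (graphWord y) M.init l c → l.length < r ^ t) :
    ∃ e', Comp U (s + t * (Nat.card κ *
        ((Nat.card (BoundedConfig M (edgeList n).length S) + 1) ^ (r + 1) +
        (Nat.card (BoundedConfig M (edgeList n).length S) + 1) ^ 2))) (d + 2 * t) e'
      (F ∪ {p | ∃ k, p = fun x => φ (M.acceptingPaths (graphWord (Y k x))).ncard}) := by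
  classical
  have := Fintype.ofFinite (BoundedConfig M (edgeList n).length S)
  have key := h.matrix_pow_pow hand hφ hop
    (fun k x => configMatrix M (graphWord (Y k x)) (edgeList n).length S) (by
      rintro k (_ | c) (_ | c')
      · convert hT using 1
        ext x
        simp [configMatrix, hφ.one]
      · convert hF using 1
        ext x
        simp [configMatrix, hφ.zero]
      · exact inputAt_mem (Y k) hT hF (hY k)
          (fun σ => φ (if M.transition c.1.state σ (c.1.tape c.1.workPos) = ∅ ∧
            c.1.state ∈ M.accept then 1 else 0)) c.1.inputPos
      · have := inputAt_mem (Y k) hT hF (hY k)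
          (fun σ => φ {a | a ∈ M.transition c.1.state σ (c.1.tape c.1.workPos) ∧
            M.next (graphWord fun _ : EdgeVar n => false) c.1 a = c'.1}.ncard) c.1.inputPos
        convert this using 1
        ext x
        simp only [configMatrix, NTM.actions, NTM.next, graphWord_length]) r t
  rw [Fintype.card_option, ← Nat.card_eq_fintype_card] at key
  refine ⟨_, key.mono subset_rfl le_rfl le_rfl le_rfl ?_⟩
  rintro p (hp | ⟨k, rfl⟩)
  · exact Or.inl hp
  · have hinit : M.init.inputPos ≤ (edgeList n).length + 1 ∧ M.init.workPos ≤ S ∧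
        ∀ p, S < p → M.init.tape p = M.blank := ⟨Nat.zero_le _, Nat.zero_le _, fun _ _ => rfl⟩
    refine Or.inr ⟨k, some ⟨M.init, hinit⟩, none, ?_⟩
    ext x
    rw [configMatrix_pow (graphWord_length _) _ _ fun p c' hrun => hS _ _ _ hrun,
      acceptingPaths_eq (htime _)]

end MachineCircuits

/-! ### Polynomial bounds -/

/-- The sequence `g` is bounded by a polynomial. The base `n + 2` makes the bound uniform in
`n ≥ 0`. -/
def PolyBdd (g : ℕ → ℕ) : Prop := ∃ C, ∀ n, g n ≤ (n + 2) ^ C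

theorem PolyBdd.mono {g h : ℕ → ℕ} (hh : PolyBdd h) (hgh : ∀ n, g n ≤ h n) : PolyBdd g :=
  hh.imp fun _ hC n => (hgh n).trans (hC n)

theorem PolyBdd.const (a : ℕ) : PolyBdd fun _ => a :=
  ⟨a, fun n => Nat.lt_two_pow_self.le.trans (Nat.pow_le_pow_left (by omega) a)⟩

theorem PolyBdd.id : PolyBdd fun n => n := ⟨1, fun n => by simp⟩

theorem PolyBdd.mul {g h : ℕ → ℕ} : PolyBdd g → PolyBdd h → PolyBdd fun n => g n * h n := by
  rintro ⟨C, hC⟩ ⟨D, hD⟩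
  exact ⟨C + D, fun n => by rw [pow_add]; exact Nat.mul_le_mul (hC n) (hD n)⟩

theorem PolyBdd.add {g h : ℕ → ℕ} : PolyBdd g → PolyBdd h → PolyBdd fun n => g n + h n := by
  rintro ⟨C, hC⟩ ⟨D, hD⟩
  refine ⟨max C D + 1, fun n => ?_⟩
  have h1 := (hC n).trans (Nat.pow_le_pow_right (by omega) (le_max_left C D) : (n + 2) ^ C ≤ _)
  have h2 := (hD n).trans (Nat.pow_le_pow_right (by omega) (le_max_right C D) : (n + 2) ^ D ≤ _)
  rw [pow_succ]
  nlinarith [Nat.zero_le ((n + 2) ^ max C D * n)]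

theorem PolyBdd.pow {g : ℕ → ℕ} (h : PolyBdd g) (k : ℕ) : PolyBdd fun n => g n ^ k := by
  obtain ⟨C, hC⟩ := h
  exact ⟨C * k, fun n => by rw [pow_mul]; exact Nat.pow_le_pow_left (hC n) k⟩

theorem PolyBdd.polynomial_eval {g : ℕ → ℕ} (h : PolyBdd g) (p : Polynomial ℕ) :
    PolyBdd fun n => p.eval (g n) := by
  induction p using Polynomial.induction_on' with
  | add p q hp hq => simpa using hp.add hq
  | monomial k a => simpa using (PolyBdd.const a).mul (h.pow k)

theorem PolyBdd.exp_log {g : ℕ → ℕ} (h : PolyBdd g) (a k : ℕ) :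
    PolyBdd fun n => a ^ (k * (Nat.log 2 (g n) + 1) + 1) := by
  refine (((h.add (PolyBdd.const 1)).pow (a * k)).mul (PolyBdd.const (2 ^ (a * k + a)))).mono
    fun n => ?_
  have h1 : 2 ^ Nat.log 2 (g n) ≤ g n + 1 := by
    rcases Nat.eq_zero_or_pos (g n) with h | h
    · simp [h]
    · exact (Nat.pow_log_le_self 2 h.ne').trans (Nat.le_succ _)
  calc a ^ (k * (Nat.log 2 (g n) + 1) + 1) ≤ (2 ^ a) ^ (k * (Nat.log 2 (g n) + 1) + 1) :=
        Nat.pow_le_pow_left Nat.lt_two_pow_self.le _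
    _ = (2 ^ Nat.log 2 (g n)) ^ (a * k) * 2 ^ (a * k + a) := by
        rw [← pow_mul, ← pow_mul, ← pow_add]; congr 1; ring
    _ ≤ _ := Nat.mul_le_mul_right _ (Nat.pow_le_pow_left h1 _)

theorem PolyBdd.log {g : ℕ → ℕ} (h : PolyBdd g) : PolyBdd fun n => Nat.log 2 (g n) :=
  h.mono fun _ => Nat.log_le_self 2 _

/-! ### The number of vertices after padding -/

section Growth

variable {u : ℕ → ℝ} {n₀ : ℕ}

theorem le_ceil_two_rpow {n : ℕ} (hn : 0 < n) (h : Real.logb 2 n ≤ u n) :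
    n ≤ ⌈(2 : ℝ) ^ u n⌉₊ := by
  have : (n : ℝ) ≤ (2 : ℝ) ^ u n := by
    rw [← Real.logb_le_iff_le_rpow (by norm_num) (by exact_mod_cast hn)]
    exact h
  exact_mod_cast this.trans (Nat.le_ceil _)

/-- If `u` is above the binary logarithm and grows faster, then the numbers `2 ^ u n` increase by at
least one in every step, so that they remain distinct after rounding. -/
theorem ceil_two_rpow_injOn (hn₀ : 0 < n₀) (h : ∀ n ≥ n₀, Real.logb 2 n ≤ u n)
    (h' : ∀ n ≥ n₀, Real.logb 2 (n + 1 : ℕ) - Real.logb 2 n ≤ u (n + 1) - u n) :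
    Set.InjOn (fun n => ⌈(2 : ℝ) ^ u n⌉₊) {n | n₀ ≤ n} := by
  have step : ∀ n ≥ n₀, ⌈(2 : ℝ) ^ u n⌉₊ < ⌈(2 : ℝ) ^ u (n + 1)⌉₊ := by
    intro n hn
    have hn0 : (0 : ℝ) < n := by exact_mod_cast hn₀.trans_le hn
    have h1 : (n : ℝ) ≤ (2 : ℝ) ^ u n := by
      rw [← Real.logb_le_iff_le_rpow (by norm_num) hn0]
      exact h n hn
    have h2 : (2 : ℝ) ^ u n + 1 ≤ (2 : ℝ) ^ u (n + 1) := by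
      calc (2 : ℝ) ^ u n + 1 ≤ (2 : ℝ) ^ u n * (((n + 1 : ℕ) : ℝ) / n) := by
            have : ((n + 1 : ℕ) : ℝ) / n = 1 + 1 / n := by push_cast; field_simp
            rw [this, mul_add, mul_one]
            have : 1 ≤ (2 : ℝ) ^ u n * (1 / n) := by
              rw [mul_one_div, le_div_iff₀ hn0]; linarith
            linarith
        _ = (2 : ℝ) ^ (u n + (Real.logb 2 (n + 1 : ℕ) - Real.logb 2 n)) := by
            rw [Real.rpow_add (by norm_num), Real.rpow_sub (by norm_num),
              Real.rpow_logb (by norm_num) (by norm_num) (by positivity),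
              Real.rpow_logb (by norm_num) (by norm_num) hn0]
        _ ≤ (2 : ℝ) ^ u (n + 1) :=
            Real.rpow_le_rpow_of_exponent_le (by norm_num) (by linarith [h' n hn])
    have h3 : ⌈(2 : ℝ) ^ u n⌉₊ + 1 ≤ ⌈(2 : ℝ) ^ u (n + 1)⌉₊ := by
      rw [← Nat.ceil_add_one (by positivity)]
      exact Nat.ceil_le_ceil h2
    omega
  have mono : ∀ n ≥ n₀, ∀ m, n < m → ⌈(2 : ℝ) ^ u n⌉₊ < ⌈(2 : ℝ) ^ u m⌉₊ := by
    intro n hn m hm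
    induction m, hm using Nat.le_induction with
    | base => exact step n hn
    | succ m hm ih => exact ih.trans (step m (by omega))
  intro a ha b hb hab
  rcases lt_trichotomy a b with hl | hl | hl
  · exact absurd hab (mono a ha b hl).ne
  · exact hl
  · exact absurd hab (mono b hb a hl).ne'

end Growth

open Classical in
/-- The padded properties of all `f n` with `n ≥ n₀`, where `f n` is padded to `Nf n` vertices. -/
noncomputable def paddedFamily (f : (n : ℕ) → (EdgeVar n → Bool) → Bool) (Nf : ℕ → ℕ) (n₀ N : ℕ) :
    (EdgeVar N → Bool) → Bool :=
  if h : ∃ n, n₀ ≤ n ∧ Nf n = N then padded (f h.choose) N else fun _ => false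

section Family

variable {f : (n : ℕ) → (EdgeVar n → Bool) → Bool} {Nf : ℕ → ℕ} {n₀ : ℕ}

theorem paddedFamily_cases (N : ℕ) :
    (∃ n, n₀ ≤ n ∧ Nf n = N ∧ paddedFamily f Nf n₀ N = padded (f n) N) ∨
      paddedFamily f Nf n₀ N = fun _ => false := by
  by_cases h : ∃ n, n₀ ≤ n ∧ Nf n = N
  · exact Or.inl ⟨h.choose, h.choose_spec.1, h.choose_spec.2, by rw [paddedFamily, dif_pos h]⟩
  · exact Or.inr (by rw [paddedFamily, dif_neg h])

theorem paddedFamily_monotone (hf : ∀ n, Monotone (f n)) (N : ℕ) :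
    Monotone (paddedFamily f Nf n₀ N) := by
  rcases paddedFamily_cases (f := f) (Nf := Nf) (n₀ := n₀) N with ⟨n, -, -, h⟩ | h
  · rw [h]; exact padded_monotone (hf n) N
  · rw [h]; exact monotone_const

theorem paddedFamily_isGraphProperty (N : ℕ) : IsGraphProperty (paddedFamily f Nf n₀ N) := by
  rcases paddedFamily_cases (f := f) (Nf := Nf) (n₀ := n₀) N with ⟨n, -, -, h⟩ | h
  · rw [h]; exact padded_isGraphProperty (f n) N
  · rw [h]; exact fun _ _ _ => rfl

theorem paddedFamily_apply (hinj : Set.InjOn Nf {n | n₀ ≤ n}) {n : ℕ} (hn : n₀ ≤ n) :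
    paddedFamily f Nf n₀ (Nf n) = padded (f n) (Nf n) := by
  have h : ∃ n', n₀ ≤ n' ∧ Nf n' = Nf n := ⟨n, hn, rfl⟩
  rw [paddedFamily, dif_pos h]
  have : h.choose = n := hinj h.choose_spec.1 hn h.choose_spec.2
  rw [this]

theorem isMonotoneProjection_paddedFamily (hf : ∀ n, Monotone (f n))
    (hf' : ∀ n, IsGraphProperty (f n)) (hinj : Set.InjOn Nf {n | n₀ ≤ n}) {n : ℕ} (hn : n₀ ≤ n)
    (h0 : 0 < n) (hnN : n ≤ Nf n) :
    IsMonotoneProjection (f n) (paddedFamily f Nf n₀ (Nf n)) := by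
  rw [paddedFamily_apply hinj hn]
  exact isMonotoneProjection_padded hnN (hf n) (hf' n) h0

end Family

theorem isAlmostQuadratic_of_eventually {s : ℕ → ℕ}
    (h : ∀ δ : ℝ, 0 < δ → ∀ᶠ N : ℕ in atTop, (s N : ℝ) ≤ (N : ℝ) ^ (2 + δ)) :
    IsAlmostQuadratic s := by
  refine ⟨fun N => max 0 (Real.logb N (max (s N) 1) - 2), ?_, ?_⟩
  · rw [Metric.tendsto_nhds]
    intro δ hδ
    filter_upwards [h (δ / 2) (by positivity), eventually_ge_atTop 2] with N hN hN2
    have hN1 : (1 : ℝ) < N := by exact_mod_cast hN2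
    rw [Real.dist_eq, sub_zero, abs_of_nonneg (le_max_left _ _)]
    refine max_lt hδ ?_
    have : Real.logb N (max (s N) 1) ≤ 2 + δ / 2 := by
      rw [Real.logb_le_iff_le_rpow hN1 (by positivity)]
      exact max_le hN (Real.one_le_rpow hN1.le (by positivity))
    linarith
  · filter_upwards [eventually_ge_atTop 2] with N hN2
    have hN1 : (1 : ℝ) < N := by exact_mod_cast hN2
    calc (s N : ℝ) ≤ max (s N : ℝ) 1 := le_max_left _ _
      _ = (N : ℝ) ^ Real.logb N (max (s N) 1) :=
        (Real.rpow_logb (by positivity) hN1.ne' (by positivity)).symm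
      _ ≤ _ := Real.rpow_le_rpow_of_exponent_le hN1.le (by
        have := le_max_right 0 (Real.logb N (max (s N) 1) - 2)
        linarith)

/-! ### Circuits for the padded property -/

theorem exists_hash_bound {N n l : ℕ} (h : N ≤ 2 ^ l) :
    4 ≤ n ^ 2 * l + 4 ∧ (n ^ 2 * l + 4) * N ^ n ^ 2 ≤ 4 ^ (n ^ 2 * l + 4) := by
  refine ⟨by omega, ?_⟩
  have h1 : N ^ n ^ 2 ≤ 2 ^ (n ^ 2 * l + 4) :=
    calc N ^ n ^ 2 ≤ (2 ^ l) ^ n ^ 2 := Nat.pow_le_pow_left h _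
      _ = 2 ^ (n ^ 2 * l) := by rw [← pow_mul, mul_comm]
      _ ≤ _ := Nat.pow_le_pow_right (by norm_num) (by omega)
  calc (n ^ 2 * l + 4) * N ^ n ^ 2 ≤ 2 ^ (n ^ 2 * l + 4) * 2 ^ (n ^ 2 * l + 4) :=
        Nat.mul_le_mul Nat.lt_two_pow_self.le h1
    _ = 4 ^ (n ^ 2 * l + 4) := by rw [← mul_pow, show 2 * 2 = 4 from rfl]

/-- The padded version of a property decided by a machine. The bound `B` covers the number of
states of the counting automata and the number of configurations. -/
theorem comp_padded_machine {N n l r t S B : ℕ} (hn : 0 < n) (hnN : n ≤ N) (hN : N ≤ 2 ^ l)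
    {f : (EdgeVar n → Bool) → Bool} (hf : Monotone f) (hf' : IsGraphProperty f) (M : NTM)
    {φ : ℕ → Prop} {op : GateOp} (hφ : IsCounting φ op) {U : Set GateOp} (hU : andOr ⊆ U)
    (hop : op ∈ U) (hM : ∀ y, f y = true ↔ φ (M.acceptingPaths (graphWord y)).ncard)
    (hS : ∀ (y : EdgeVar n → Bool) p c, M.Run (graphWord y) M.init p c → c.workPos ≤ S)
    (htime : ∀ (y : EdgeVar n → Bool) p c, M.Run (graphWord y) M.init p c → p.length < r ^ t)
    (hr : 0 < r) (hrt : 2 * (n ^ 2 * l + 4) ≤ r ^ t)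
    (hB : (2 * (n ^ 2 * l + 4) + 1) * (n + 1) ≤ B)
    (hB' : Nat.card (BoundedConfig M (edgeList n).length S) + 1 ≤ B) :
    ∃ e, Comp U (16 * N ^ 2 + (19 + 6 * t) * B ^ (r + 3)) (13 + 4 * t) e
      {fun x => padded f N x = true} := by
  obtain ⟨hk, hkN⟩ := exists_hash_bound (n := n) hN
  set k := n ^ 2 * l + 4
  have h1 := comp_compacted N (2 * k) n r t (by omega) hn hrt
  obtain ⟨e', h2⟩ := (h1.mono hU le_rfl le_rfl le_rfl subset_rfl).machine (hU (by simp [andOr])) hφ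
    hop (κ := Fin (2 * k)) (fun q x => compacted (2 * k) n q x) (Or.inr (Or.inl rfl))
    (Or.inr (Or.inr (Or.inl rfl))) (fun q i b => Or.inr (Or.inr (Or.inr ⟨q, i, b, rfl⟩))) M r t S
    hS htime
  have h3 := h2.padded (hn.trans_le hnN) hn hnN hk hkN hf hf' hU
    (fun q => ⟨Or.inl (Or.inl ⟨q, Or.inl rfl⟩), Or.inl (Or.inl ⟨q, Or.inr (Or.inl rfl)⟩)⟩)
    (fun q => Or.inl (Or.inl ⟨q, Or.inr (Or.inr rfl)⟩))
    (fun q => Or.inr ⟨q, by ext x; exact hM _⟩)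
  refine ⟨_, h3.mono subset_rfl ?_ (by omega) le_rfl subset_rfl⟩
  have hk2 : 4 * k + 2 ≤ B := le_trans (by nlinarith) hB
  have b1 : ((2 * k + 1) * (n + 1)) ^ (r + 3) ≤ B ^ (r + 3) := Nat.pow_le_pow_left hB _
  have b2 : 2 * k * ((Nat.card (BoundedConfig M (edgeList n).length S) + 1) ^ (r + 1) +
      (Nat.card (BoundedConfig M (edgeList n).length S) + 1) ^ 2) ≤ 2 * B ^ (r + 3) := by
    have e1 := Nat.pow_le_pow_left hB' (r + 1)
    have e2 := Nat.pow_le_pow_left hB' 2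
    have e3 : B ^ 2 ≤ B ^ (r + 1) := Nat.pow_le_pow_right (by omega) (by omega)
    have e4 : B ^ (r + 2) ≤ B ^ (r + 3) := Nat.pow_le_pow_right (by omega) (by omega)
    calc _ ≤ B * (B ^ (r + 1) + B ^ (r + 1)) := Nat.mul_le_mul (by omega) (by omega)
      _ = 2 * B ^ (r + 2) := by ring
      _ ≤ _ := by omega
  have b3 : B ≤ B ^ (r + 3) := Nat.le_self_pow (by omega) B
  have b4 := Nat.mul_le_mul_left t b2
  have b5 := Nat.mul_le_mul_left (18 + 4 * t) b1
  rw [Nat.card_fin]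
  calc _ ≤ 16 * N ^ 2 + (18 + 4 * t) * B ^ (r + 3) + t * (2 * B ^ (r + 3)) + B ^ (r + 3) := by omega
    _ = _ := by ring

/-- The padded version of a property computed by a circuit of fan-in two. -/
theorem comp_padded_circuit {N n l t : ℕ} (hn : 0 < n) (hnN : n ≤ N) (hN : N ≤ 2 ^ l)
    {f : (EdgeVar n → Bool) → Bool} (hf : Monotone f) (hf' : IsGraphProperty f)
    (C : Circuit (EdgeVar n)) (hC : C.Computes f) (hC1 : C.IsAndOr) (hC2 : C.FanInTwo)
    (ht : 2 * (n ^ 2 * l + 4) ≤ 2 ^ t) :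
    ∃ d, Comp andOr (16 * N ^ 2 + ((18 + 4 * t) *
        ((2 * (n ^ 2 * l + 4) + 1) * (n + 1)) ^ 5 + C.depth * (2 * (n ^ 2 * l + 4) * C.size) +
        (4 * (n ^ 2 * l + 4) + 2))) d
      (23 + 7 * Nat.clog 2 N + 5 * Nat.clog 2 ((2 * (n ^ 2 * l + 4) + 1) * (n + 1)) +
        t * (3 * Nat.clog 2 ((2 * (n ^ 2 * l + 4) + 1) * (n + 1)) + 3) + 2 * C.depth)
      {fun x => padded f N x = true} := by
  obtain ⟨hk, hkN⟩ := exists_hash_bound (n := n) hN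
  set k := n ^ 2 * l + 4
  have h1 := comp_compacted N (2 * k) n 2 t (by omega) hn ht
  have h2 := h1.substitute (κ := Fin (2 * k)) (fun q x => compacted (2 * k) n q x)
    (fun q i b => Or.inr (Or.inr (Or.inr ⟨q, i, b, rfl⟩))) C (fun k => hC1 k) hC2
  have h3 := h2.padded (hn.trans_le hnN) hn hnN hk hkN hf hf' subset_rfl
    (fun q => ⟨Or.inl (Or.inl ⟨q, Or.inl rfl⟩), Or.inl (Or.inl ⟨q, Or.inr (Or.inl rfl)⟩)⟩)
    (fun q => Or.inl (Or.inl ⟨q, Or.inr (Or.inr rfl)⟩))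
    (fun q => Or.inr ⟨q, by ext x; rw [← hC]⟩)
  have hcl : Nat.clog 2 2 = 1 := by decide
  have hcl' : Nat.clog 2 (2 * k + 1) ≤ Nat.clog 2 ((2 * k + 1) * (n + 1)) :=
    Nat.clog_mono_right 2 (Nat.le_mul_of_pos_right _ (by omega))
  refine ⟨_, h3.mono subset_rfl (by rw [Nat.card_fin, show 2 + 3 = 5 from rfl]; omega) le_rfl ?_
    subset_rfl⟩
  rw [hcl, show 1 + (2 + 1) * Nat.clog 2 ((2 * k + 1) * (n + 1)) + 2 =
    3 * Nat.clog 2 ((2 * k + 1) * (n + 1)) + 3 by ring]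
  omega

/-! ### Polynomial size and logarithmic depth -/

theorem le_card_edgeVar {N : ℕ} (hN : 3 ≤ N) : N ≤ Fintype.card (EdgeVar N) := by
  let g (u : Fin N) : EdgeVar N :=
    if h : (u : ℕ) + 1 < N then ⟨(u, ⟨u + 1, h⟩), by simp [Fin.lt_def]⟩
    else ⟨(⟨0, by omega⟩, ⟨N - 1, by omega⟩), by simp [Fin.lt_def]; omega⟩
  have hg : Function.Injective g := by
    intro u v huv
    have hu := u.2
    have hv := v.2
    by_cases h1 : (u : ℕ) + 1 < N <;> by_cases h2 : (v : ℕ) + 1 < N <;>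
      simp only [g, h1, h2, dif_pos, dif_neg, not_false_eq_true, Subtype.mk.injEq, Prod.mk.injEq,
        Fin.ext_iff] at huv ⊢ <;> omega
  simpa using Fintype.card_le_of_injective g hg

theorem inNC_one_of_bounds {g : (N : ℕ) → (EdgeVar N → Bool) → Bool} (A K : ℕ)
    (h : ∀ N, ∃ C : Circuit (EdgeVar N), C.Computes (g N) ∧ C.IsAndOr ∧ C.FanInTwo ∧
      C.size ≤ (16 * N ^ 2 + (N + 2) ^ A) * 2 ^ (K * Nat.log 2 N + K) ∧
      C.depth ≤ K * Nat.log 2 N + K) : InNC 1 g := by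
  refine ⟨17 * 2 ^ K * 4 ^ (A + K + 2), A + K + 2, fun N => ?_⟩
  obtain ⟨C, h1, h2, h3, h4, h5⟩ := h N
  have hsize : C.size ≤ 17 * 2 ^ K * (N + 2) ^ (A + K + 2) := by
    have e1 : 2 ^ Nat.log 2 N ≤ N + 2 := by
      rcases Nat.eq_zero_or_pos N with h | h
      · simp [h]
      · exact (Nat.pow_log_le_self 2 h.ne').trans (by omega)
    have e2 : N ^ 2 ≤ (N + 2) ^ (A + 2) :=
      (Nat.pow_le_pow_left (by omega) 2).trans (Nat.pow_le_pow_right (by omega) (by omega))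
    have e3 : (N + 2) ^ A ≤ (N + 2) ^ (A + 2) := Nat.pow_le_pow_right (by omega) (by omega)
    have e4 : 2 ^ (K * Nat.log 2 N + K) ≤ (N + 2) ^ K * 2 ^ K := by
      rw [pow_add, mul_comm K, pow_mul]
      exact Nat.mul_le_mul_right _ (Nat.pow_le_pow_left e1 K)
    calc C.size ≤ _ := h4
      _ ≤ (17 * (N + 2) ^ (A + 2)) * ((N + 2) ^ K * 2 ^ K) := Nat.mul_le_mul (by omega) e4
      _ = _ := by ring
  have hK : 2 * K ≤ 17 * 2 ^ K * 4 ^ (A + K + 2) := by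
    have e1 : K < 2 ^ K := Nat.lt_two_pow_self
    have e2 : 0 < 4 ^ (A + K + 2) := by positivity
    nlinarith [Nat.mul_le_mul_left (17 * 2 ^ K) e2]
  refine ⟨C, h1, h2, h3, ?_, ?_⟩
  · rcases le_or_gt 3 N with hN | hN
    · have e1 : (N + 2) ^ (A + K + 2) ≤ (4 * Fintype.card (EdgeVar N)) ^ (A + K + 2) :=
        Nat.pow_le_pow_left (by have := le_card_edgeVar hN; omega) _
      calc C.size ≤ _ := hsize
        _ ≤ 17 * 2 ^ K * (4 * Fintype.card (EdgeVar N)) ^ (A + K + 2) := Nat.mul_le_mul_left _ e1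
        _ = 17 * 2 ^ K * 4 ^ (A + K + 2) * Fintype.card (EdgeVar N) ^ (A + K + 2) := by
          rw [mul_pow, ← mul_assoc]
        _ ≤ _ := Nat.le_add_right _ _
    · refine (hsize.trans (Nat.mul_le_mul_left _ ?_)).trans (Nat.le_add_left _ _)
      exact Nat.pow_le_pow_left (by omega) _
  · rcases le_or_gt 3 N with hN | hN
    · have e1 : Nat.log 2 N ≤ Nat.log 2 (Fintype.card (EdgeVar N)) :=
        Nat.log_mono_right (le_card_edgeVar hN)
      rw [pow_one]
      refine h5.trans (Nat.add_le_add (Nat.mul_le_mul ?_ e1) ?_) <;> omega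
    · have e1 : Nat.log 2 N ≤ 1 := by
        have : Nat.log 2 N ≤ Nat.log 2 2 := Nat.log_mono_right (by omega)
        rwa [show Nat.log 2 2 = 1 by decide] at this
      have e2 : K * Nat.log 2 N ≤ K * 1 := Nat.mul_le_mul_left K e1
      omega

theorem logb_natCast_nonneg {n : ℕ} (hn : 1 ≤ n) : 0 ≤ Real.logb 2 n :=
  Real.logb_nonneg (by norm_num) (by exact_mod_cast hn)

theorem logb_eq_zero_or_one_le {n : ℕ} (hn : 1 ≤ n) : Real.logb 2 n = 0 ∨ 1 ≤ Real.logb 2 n := by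
  rcases hn.eq_or_lt with rfl | h
  · left; simp
  · right
    rw [Real.le_logb_iff_rpow_le (by norm_num) (by positivity)]
    simpa using (by exact_mod_cast h : (2 : ℝ) ≤ n)

theorem logb_le_logb_pow {n i : ℕ} (hn : 1 ≤ n) (hi : 1 ≤ i) :
    Real.logb 2 n ≤ Real.logb 2 n ^ i := by
  rcases logb_eq_zero_or_one_le hn with h | h
  · rw [h]; positivity
  · exact le_self_pow₀ h (by omega)

theorem logb_succ_sub_le {n i : ℕ} (hn : 1 ≤ n) (hi : 1 ≤ i) :
    Real.logb 2 (n + 1 : ℕ) - Real.logb 2 n ≤ Real.logb 2 (n + 1 : ℕ) ^ i - Real.logb 2 n ^ i := by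
  obtain ⟨j, rfl⟩ : ∃ j, i = j + 1 := ⟨i - 1, by omega⟩
  have hle : Real.logb 2 n ≤ Real.logb 2 (n + 1 : ℕ) := by
    apply Real.logb_le_logb_of_le (by norm_num) (by exact_mod_cast hn)
    push_cast; linarith
  have h1 : 1 ≤ Real.logb 2 (n + 1 : ℕ) := by
    rw [Real.le_logb_iff_rpow_le (by norm_num) (by positivity)]
    simpa using (by exact_mod_cast (by omega : 2 ≤ n + 1) : (2 : ℝ) ≤ (n + 1 : ℕ))
  -- `x ^ (j + 1) - x = x * (x ^ j - 1)` is monotone for `x ≥ 1` and vanishes at `0`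
  rcases logb_eq_zero_or_one_le hn with h | h
  · rw [h]
    have := le_self_pow₀ (n := j + 1) h1 (by omega)
    simpa using this
  · set a := Real.logb 2 n
    set b := Real.logb 2 (n + 1 : ℕ)
    have e1 : a ^ j ≤ b ^ j := pow_le_pow_left₀ (by linarith) hle j
    have e2 : 1 ≤ a ^ j := one_le_pow₀ h
    have e3 : a * (a ^ j - 1) ≤ b * (b ^ j - 1) :=
      mul_le_mul hle (by linarith) (by linarith) (by linarith)
    rw [pow_succ', pow_succ']
    linarith

theorem natLog_bounds {n i : ℕ} (hn : 1 ≤ n) :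
    2 ^ Nat.log 2 n ^ i ≤ ⌈(2 : ℝ) ^ (Real.logb 2 (n : ℝ) ^ i)⌉₊ ∧
      ⌈(2 : ℝ) ^ (Real.logb 2 (n : ℝ) ^ i)⌉₊ ≤ 2 ^ (Nat.log 2 n + 1) ^ i := by
  have hn0 : (0 : ℝ) < n := by exact_mod_cast hn
  have h1 : (Nat.log 2 n : ℝ) ≤ Real.logb 2 n := by
    rw [Real.le_logb_iff_rpow_le (by norm_num) hn0, Real.rpow_natCast]
    exact_mod_cast Nat.pow_log_le_self 2 (by omega)
  have h2 : Real.logb 2 n ≤ (Nat.log 2 n + 1 : ℕ) := by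
    rw [Real.logb_le_iff_le_rpow (by norm_num) hn0, Real.rpow_natCast]
    exact_mod_cast (Nat.lt_pow_succ_log_self (by norm_num) n).le
  constructor
  · have : ((2 ^ Nat.log 2 n ^ i : ℕ) : ℝ) ≤ (2 : ℝ) ^ (Real.logb 2 (n : ℝ) ^ i) := by
      push_cast
      rw [← Real.rpow_natCast]
      apply Real.rpow_le_rpow_of_exponent_le (by norm_num)
      push_cast
      exact pow_le_pow_left₀ (by positivity) h1 i
    exact_mod_cast this.trans (Nat.le_ceil _)
  · rw [Nat.ceil_le, Nat.cast_pow, Nat.cast_ofNat, ← Real.rpow_natCast 2]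
    apply Real.rpow_le_rpow_of_exponent_le (by norm_num)
    push_cast
    refine pow_le_pow_left₀ (logb_natCast_nonneg hn) ?_ i
    exact_mod_cast h2

/-- A circuit for the constant `false`. -/
theorem exists_circuit_false {ι : Type} {U : Set GateOp} (hU : andOr ⊆ U) :
    ∃ C : Circuit ι, C.Computes (fun _ => false) ∧ (∀ k, C.op k ∈ U) ∧ C.FanInTwo ∧
      C.size ≤ 4 ∧ C.depth ≤ 1 := by
  obtain ⟨C, h1, h2, h3, h4, h5⟩ := ((comp_literals (ι := ι) U).constants hU).exists_circuit_fanInTwo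
    (p := fun _ => False) (by simp)
  refine ⟨C, fun x => ?_, h2, h3, by simpa using h1, h4⟩
  rw [Bool.eq_iff_iff]
  simpa using h5 x

theorem clog_le_mul_log {n C x : ℕ} (hx : x ≤ (n + 2) ^ C) :
    Nat.clog 2 x ≤ C * (Nat.log 2 n + 2) := by
  have h1 : Nat.clog 2 (n + 2) ≤ Nat.log 2 n + 2 := by
    rw [Nat.clog_le_iff_le_pow (by norm_num), pow_succ]
    have e1 := Nat.lt_pow_succ_log_self (b := 2) (by norm_num) n
    omega
  exact (Nat.clog_mono_right 2 hx).trans ((clog_pow_le _ _).trans (Nat.mul_le_mul_left C h1))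

theorem polyBdd_log_pow (i : ℕ) : PolyBdd fun n => (Nat.log 2 n + 1) ^ i :=
  (PolyBdd.id.log.add (PolyBdd.const 1)).pow i

theorem exists_inNC_one_of_inNC {f : (n : ℕ) → (EdgeVar n → Bool) → Bool}
    (hmono : ∀ n, Monotone (f n)) (hgraph : ∀ n, IsGraphProperty (f n)) {i : ℕ} (hi : 1 < i)
    (hNC : InNC i f) :
    ∃ g : (N : ℕ) → (EdgeVar N → Bool) → Bool,
      (∀ N, Monotone (g N)) ∧ (∀ N, IsGraphProperty (g N)) ∧ InNC 1 g ∧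
        ∀ n : ℕ, 1 ≤ n →
          IsMonotoneProjection (f n) (g ⌈(2 : ℝ) ^ (Real.logb 2 (n : ℝ) ^ i)⌉₊) := by
  let Nf : ℕ → ℕ := fun n => ⌈(2 : ℝ) ^ (Real.logb 2 (n : ℝ) ^ i)⌉₊
  have hinj : Set.InjOn Nf {n | 1 ≤ n} :=
    ceil_two_rpow_injOn (u := fun n => Real.logb 2 (n : ℝ) ^ i) one_pos
      (fun n hn => logb_le_logb_pow hn hi.le) fun n hn => logb_succ_sub_le hn hi.le
  have hle : ∀ n, 1 ≤ n → n ≤ Nf n := fun n hn =>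
    le_ceil_two_rpow (u := fun n => Real.logb 2 (n : ℝ) ^ i) hn (logb_le_logb_pow hn hi.le)
  refine ⟨paddedFamily f Nf 1, paddedFamily_monotone hmono, paddedFamily_isGraphProperty, ?_,
    fun n hn => isMonotoneProjection_paddedFamily hmono hgraph hinj hn hn (hle n hn)⟩
  obtain ⟨c, e, hC⟩ := hNC
  choose C hcomp hAO hF2 hsize hdepth using hC
  let k : ℕ → ℕ := fun n => n ^ 2 * (Nat.log 2 n + 1) ^ i + 4
  let t : ℕ → ℕ := fun n => Nat.clog 2 (2 * k n)
  let P : ℕ → ℕ := fun n => (2 * k n + 1) * (n + 1)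
  have hcard : ∀ n, Fintype.card (EdgeVar n) ≤ n * n := fun n => by
    rw [← Nat.card_eq_fintype_card]; exact card_edgeVar_le n
  have hclog : ∀ x, Nat.clog 2 x ≤ x := fun x =>
    (Nat.clog_le_iff_le_pow (by norm_num)).2 Nat.lt_two_pow_self.le
  have pk : PolyBdd k := ((PolyBdd.id.pow 2).mul (polyBdd_log_pow i)).add (PolyBdd.const 4)
  have pt : PolyBdd t := ((PolyBdd.const 2).mul pk).mono fun n => hclog _
  have pP : PolyBdd P :=
    (((PolyBdd.const 2).mul pk).add (PolyBdd.const 1)).mul (PolyBdd.id.add (PolyBdd.const 1))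
  have pm : PolyBdd fun n => Fintype.card (EdgeVar n) := (PolyBdd.id.mul PolyBdd.id).mono hcard
  have pS : PolyBdd fun n => (C n).size :=
    (((PolyBdd.const c).mul (pm.pow e)).add (PolyBdd.const c)).mono hsize
  have pD : PolyBdd fun n => (C n).depth :=
    (((PolyBdd.const c).mul (pm.log.pow i)).add (PolyBdd.const c)).mono hdepth
  obtain ⟨A, hA⟩ : PolyBdd fun n => (18 + 4 * t n) * P n ^ 5 + (C n).depth * (2 * k n * (C n).size) +
      (4 * k n + 2) :=
    ((((PolyBdd.const 18).add ((PolyBdd.const 4).mul pt)).mul (pP.pow 5)).add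
      (pD.mul (((PolyBdd.const 2).mul pk).mul pS))).add
      (((PolyBdd.const 4).mul pk).add (PolyBdd.const 2))
  obtain ⟨B, hB⟩ := pP
  -- the depth is bounded by a multiple of `(log n + 2) ^ i`
  let K₀ := 30 + 5 * B + B * (3 * B + 3) + 2 * (c * 2 ^ i + c)
  have hE : ∀ n, 1 ≤ n → 23 + 7 * Nat.clog 2 (Nf n) + 5 * Nat.clog 2 (P n) +
      t n * (3 * Nat.clog 2 (P n) + 3) + 2 * (C n).depth ≤ K₀ * (Nat.log 2 n + 2) ^ i := by
    intro n hn
    set a := Nat.log 2 n + 2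
    have e0 : 1 ≤ a ^ i := Nat.one_le_pow _ _ (by omega)
    have e1 : a ≤ a ^ i := Nat.le_self_pow (by omega) a
    have e2 : a * a ≤ a ^ i := by
      rw [← sq]; exact Nat.pow_le_pow_right (by omega) hi
    have e3 : Nat.clog 2 (Nf n) ≤ a ^ i :=
      ((Nat.clog_le_iff_le_pow (by norm_num)).2 (natLog_bounds hn).2).trans
        (Nat.pow_le_pow_left (by omega) i)
    have e4 : Nat.clog 2 (P n) ≤ B * a := clog_le_mul_log (hB n)
    have e5 : t n ≤ B * a := le_trans (Nat.clog_mono_right 2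
      (by simp only [P]; nlinarith)) e4
    have e6 : t n * (3 * Nat.clog 2 (P n) + 3) ≤ B * (3 * B + 3) * a ^ i := by
      calc t n * (3 * Nat.clog 2 (P n) + 3) ≤ (B * a) * (3 * (B * a) + 3 * a) :=
            Nat.mul_le_mul e5 (by omega)
        _ = B * (3 * B + 3) * (a * a) := by ring
        _ ≤ _ := Nat.mul_le_mul_left _ e2
    have e7 : B * a ≤ B * a ^ i := Nat.mul_le_mul_left B e1
    have e8 : (C n).depth ≤ (c * 2 ^ i + c) * a ^ i := by
      have f1 : Nat.log 2 (Fintype.card (EdgeVar n)) ≤ 2 * a := by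
        apply Nat.lt_succ_iff.1
        apply Nat.log_lt_of_lt_pow' (by omega)
        have f2 := Nat.lt_pow_succ_log_self (b := 2) (by norm_num) n
        calc Fintype.card (EdgeVar n) ≤ n * n := hcard n
          _ < 2 ^ (Nat.log 2 n + 1) * 2 ^ (Nat.log 2 n + 1) := Nat.mul_lt_mul'' f2 f2
          _ = 2 ^ (2 * Nat.log 2 n + 2) := by rw [← pow_add]; congr 1; omega
          _ ≤ _ := Nat.pow_le_pow_right (by norm_num) (by omega)
      have f3 := Nat.pow_le_pow_left f1 i
      rw [mul_pow] at f3
      calc (C n).depth ≤ _ := hdepth n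
        _ ≤ c * (2 ^ i * a ^ i) + c * a ^ i :=
          Nat.add_le_add (Nat.mul_le_mul_left c f3) (Nat.le_mul_of_pos_right c e0)
        _ = _ := by ring
    calc _ ≤ 30 * a ^ i + 5 * (B * a ^ i) + B * (3 * B + 3) * a ^ i +
          2 * ((c * 2 ^ i + c) * a ^ i) := by omega
      _ = K₀ * a ^ i := by simp only [K₀]; ring
  let K := K₀ * 3 ^ i
  have hEK : ∀ n, 1 ≤ n → K₀ * (Nat.log 2 n + 2) ^ i ≤ K * Nat.log 2 (Nf n) + K := by
    intro n hn
    have e1 : (Nat.log 2 n + 2) ^ i ≤ 3 ^ i * Nat.log 2 n ^ i + 3 ^ i := by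
      rcases Nat.eq_zero_or_pos (Nat.log 2 n) with h | h
      · rw [h]
        exact (Nat.pow_le_pow_left (by norm_num) i).trans (Nat.le_add_left _ _)
      · rw [← mul_pow]
        exact (Nat.pow_le_pow_left (by omega) i).trans (Nat.le_add_right _ _)
    have e2 : Nat.log 2 n ^ i ≤ Nat.log 2 (Nf n) :=
      Nat.le_log_of_pow_le (by norm_num) (natLog_bounds hn).1
    calc K₀ * (Nat.log 2 n + 2) ^ i ≤ K₀ * (3 ^ i * Nat.log 2 (Nf n) + 3 ^ i) :=
          Nat.mul_le_mul_left _ (e1.trans (by gcongr))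
      _ = _ := by simp only [K]; ring
  have hK2 : 2 ≤ K := by
    have : 1 ≤ 3 ^ i := Nat.one_le_pow _ _ (by norm_num)
    have h30 : 30 ≤ K₀ := by simp only [K₀]; omega
    calc 2 ≤ K₀ * 1 := by omega
      _ ≤ K := Nat.mul_le_mul_left _ this
  apply inNC_one_of_bounds A K
  intro N
  rcases paddedFamily_cases (f := f) (Nf := Nf) (n₀ := 1) N with ⟨n, hn, rfl, hg⟩ | hg
  · obtain ⟨d, hcmp⟩ := comp_padded_circuit (t := t n) hn (hle n hn) (natLog_bounds (i := i) hn).2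
      (hmono n) (hgraph n) (C n) (hcomp n) (hAO n) (hF2 n) (Nat.le_pow_clog (by norm_num) _)
    obtain ⟨D, d1, d2, d3, d4, d5⟩ := hcmp.exists_circuit_fanInTwo rfl
    have hexp := (hE n hn).trans (hEK n hn)
    refine ⟨D, fun x => ?_, d2, d3, d1.trans (Nat.mul_le_mul ?_ ?_), d4.trans hexp⟩
    · rw [hg, Bool.eq_iff_iff]; exact d5 x
    · exact Nat.add_le_add_left ((hA n).trans (Nat.pow_le_pow_left (by have := hle n hn; omega) A)) _
    · exact Nat.pow_le_pow_right (by norm_num) hexp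
  · obtain ⟨D, d1, d2, d3, d4, d5⟩ := exists_circuit_false (ι := EdgeVar N) (U := andOr) subset_rfl
    refine ⟨D, hg ▸ d1, d2, d3, d4.trans ?_, d5.trans (by omega)⟩
    calc 4 = 1 * 2 ^ 2 := by norm_num
      _ ≤ _ := Nat.mul_le_mul (le_add_left (Nat.one_le_pow _ _ (by omega)))
        (Nat.pow_le_pow_right (by norm_num) (by omega))

/-! ### Almost quadratic size and constant depth -/

theorem tendsto_natCast_rpow_atTop {ε : ℝ} (hε : 0 < ε) :
    Tendsto (fun n : ℕ => (n : ℝ) ^ ε) atTop atTop :=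
  (tendsto_rpow_atTop hε).comp tendsto_natCast_atTop_atTop

theorem eventually_logb_le_rpow {ε : ℝ} (hε : 0 < ε) :
    ∀ᶠ n : ℕ in atTop, Real.logb 2 n ≤ (n : ℝ) ^ ε := by
  have h := ((isLittleO_log_rpow_atTop hε).def (Real.log_pos (by norm_num : (1 : ℝ) < 2))).natCast_atTop
  filter_upwards [h] with n hn
  rw [Real.logb, div_le_iff₀ (Real.log_pos (by norm_num)), mul_comm]
  refine (le_abs_self _).trans ?_
  simpa [abs_of_nonneg (Real.rpow_nonneg (Nat.cast_nonneg n) ε)] using hn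

theorem eventually_logb_succ_sub_le {ε : ℝ} (hε : 0 < ε) :
    ∀ᶠ n : ℕ in atTop, Real.logb 2 (n + 1 : ℕ) - Real.logb 2 n ≤
      ((n + 1 : ℕ) : ℝ) ^ ε - (n : ℝ) ^ ε := by
  have hlog : 0 < Real.log 2 := Real.log_pos (by norm_num)
  filter_upwards [(tendsto_natCast_rpow_atTop hε).eventually_ge_atTop (1 / (ε * Real.log 2)),
    eventually_ge_atTop 1] with n hn hn1
  have hn0 : (0 : ℝ) < n := by exact_mod_cast hn1
  rw [div_le_iff₀ (by positivity)] at hn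
  set D := Real.logb 2 (n + 1 : ℕ) - Real.logb 2 n with hD
  have hD0 : 0 ≤ D := by
    rw [hD, sub_nonneg]
    apply Real.logb_le_logb_of_le (by norm_num) hn0
    push_cast; linarith
  have hDlog : D * Real.log 2 = Real.log (n + 1 : ℕ) - Real.log n := by
    rw [hD, Real.logb, Real.logb]; field_simp
  -- `(n + 1) ^ ε = n ^ ε * exp (ε * log 2 * D)`, and `exp y ≥ 1 + y`
  have h1 : ((n + 1 : ℕ) : ℝ) ^ ε = (n : ℝ) ^ ε * Real.exp (D * Real.log 2 * ε) := by
    rw [hDlog, Real.rpow_def_of_pos (by positivity), Real.rpow_def_of_pos hn0, ← Real.exp_add]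
    congr 1; ring
  have h2 := Real.add_one_le_exp (D * Real.log 2 * ε)
  have h3 : 0 < (n : ℝ) ^ ε := by positivity
  rw [h1]
  nlinarith [mul_le_mul_of_nonneg_left h2 h3.le, mul_le_mul_of_nonneg_left hn hD0]

/-- A sum of a quadratic term and a term `n ^ (C * (n ^ (ε / 2) + O(1)))` is almost quadratic
in `2 ^ n ^ ε`. -/
theorem eventually_size_le {ε δ : ℝ} (hε : 0 < ε) (hδ : 0 < δ) (C c : ℕ) (Nf : ℕ → ℕ)
    (hNf : ∀ n : ℕ, (2 : ℝ) ^ (n : ℝ) ^ ε ≤ Nf n) :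
    ∀ᶠ n : ℕ in atTop,
      ((4 + (16 * Nf n ^ 2 + c * ((n + 2) ^ C) ^ (⌈(n : ℝ) ^ (ε / 2)⌉₊ + 3)) : ℕ) : ℝ) ≤
        (Nf n : ℝ) ^ (2 + δ) := by
  filter_upwards [eventually_logb_le_rpow (by positivity : 0 < ε / 4), eventually_ge_atTop 2,
    (tendsto_natCast_rpow_atTop (by positivity : 0 < ε / 4)).eventually_ge_atTop
      (max 1 ((c + 6 + 10 * C) / δ))] with n hlog hn2 hy
  set y := (n : ℝ) ^ (ε / 4) with hydef
  have hn0 : (0 : ℝ) < n := by exact_mod_cast (by omega : 0 < n)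
  have hy1 : 1 ≤ y := (le_max_left _ _).trans hy
  have hyδ : c + 6 + 10 * C ≤ δ * y := by
    have := (le_max_right _ _).trans hy
    rw [div_le_iff₀ hδ] at this
    linarith
  have hy2 : (n : ℝ) ^ (ε / 2) = y ^ 2 := by
    rw [hydef, ← Real.rpow_natCast, ← Real.rpow_mul hn0.le]; congr 1; push_cast; ring
  have hy4 : (n : ℝ) ^ ε = y ^ 4 := by
    rw [hydef, ← Real.rpow_natCast, ← Real.rpow_mul hn0.le]; congr 1; push_cast; ring
  have hN := hNf n
  rw [hy4] at hN
  have hN0 : (0 : ℝ) < Nf n := lt_of_lt_of_le (by positivity) hN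
  have hN1 : (1 : ℝ) ≤ Nf n :=
    (Real.one_le_rpow (by norm_num) (by positivity)).trans hN
  set r := ⌈(n : ℝ) ^ (ε / 2)⌉₊
  have hr : (r : ℝ) ≤ y ^ 2 + 1 := by
    rw [← hy2]; exact (Nat.ceil_lt_add_one (by positivity)).le
  have hy3 : y ^ 3 * (c + 6 + 10 * C) ≤ δ * y ^ 4 := by
    calc y ^ 3 * (c + 6 + 10 * C) ≤ y ^ 3 * (δ * y) := by gcongr
      _ = δ * y ^ 4 := by ring
  have hy13 : 1 ≤ y ^ 3 := one_le_pow₀ hy1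
  have hNδ : (2 : ℝ) ^ (δ * y ^ 4) ≤ (Nf n : ℝ) ^ δ := by
    calc (2 : ℝ) ^ (δ * y ^ 4) = ((2 : ℝ) ^ y ^ 4) ^ δ := by
          rw [mul_comm, Real.rpow_mul (by norm_num)]
      _ ≤ _ := Real.rpow_le_rpow (by positivity) hN hδ.le
  have h64 : (64 : ℝ) ≤ (Nf n : ℝ) ^ δ := by
    refine le_trans ?_ hNδ
    rw [show (64 : ℝ) = (2 : ℝ) ^ (6 : ℝ) by norm_num]
    apply Real.rpow_le_rpow_of_exponent_le (by norm_num)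
    have h0 : (0 : ℝ) ≤ c + 10 * C := by positivity
    nlinarith [mul_nonneg (by linarith : 0 ≤ y ^ 3) h0]
  have hpow : (c : ℝ) * (((n : ℝ) + 2) ^ C) ^ (r + 3) * 4 ≤ (Nf n : ℝ) ^ δ := by
    refine le_trans ?_ hNδ
    have e1 : (n : ℝ) + 2 ≤ (n : ℝ) ^ 2 := by
      have : (2 : ℝ) ≤ n := by exact_mod_cast hn2
      nlinarith
    have e2 : (n : ℝ) ≤ (2 : ℝ) ^ y := by
      rw [← Real.logb_le_iff_le_rpow (by norm_num) hn0]; exact hlog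
    have e3 : (c : ℝ) ≤ (2 : ℝ) ^ (c : ℝ) := by
      rw [Real.rpow_natCast]; exact_mod_cast Nat.lt_two_pow_self.le
    calc (c : ℝ) * (((n : ℝ) + 2) ^ C) ^ (r + 3) * 4
        ≤ (2 : ℝ) ^ (c : ℝ) * ((((2 : ℝ) ^ y) ^ 2) ^ C) ^ (r + 3) * (2 : ℝ) ^ (2 : ℝ) := by
          gcongr
          · exact e1.trans (by gcongr)
          · norm_num
      _ = (2 : ℝ) ^ (c + y * (2 * (C * (r + 3))) + 2) := by
          rw [Real.rpow_add (by norm_num), Real.rpow_add (by norm_num), Real.rpow_mul (by norm_num),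
            ← pow_mul, ← pow_mul, ← Real.rpow_natCast ((2 : ℝ) ^ y)]
          push_cast
          rfl
      _ ≤ (2 : ℝ) ^ (δ * y ^ 4) := by
          apply Real.rpow_le_rpow_of_exponent_le (by norm_num)
          refine le_trans ?_ hy3
          have f1 : (r : ℝ) + 3 ≤ 5 * y ^ 2 := by nlinarith
          have f2 : y * (2 * (C * (r + 3))) ≤ y * (2 * (C * (5 * y ^ 2))) := by gcongr
          have f3 : (c : ℝ) + 2 ≤ y ^ 3 * (c + 6) := by
            have : (0 : ℝ) ≤ c := by positivity
            nlinarith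
          nlinarith
  have hsq : (1 : ℝ) ≤ (Nf n : ℝ) ^ 2 := one_le_pow₀ hN1
  rw [Real.rpow_add hN0, Real.rpow_two]
  push_cast
  nlinarith [mul_le_mul_of_nonneg_left h64 (by linarith : (0 : ℝ) ≤ (Nf n : ℝ) ^ 2),
    mul_le_mul hsq hpow (by positivity) (by positivity)]

theorem length_edgeList_le (n : ℕ) : (edgeList n).length ≤ n * n := by
  rw [edgeList, List.length_flatMap]
  refine (List.sum_le_card_nsmul _ n ?_).trans (by simp)
  intro m hm
  obtain ⟨u, -, rfl⟩ := List.mem_map.1 hm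
  exact (List.length_filterMap_le _ _).trans (by simp)

/-- Padding a property decided by a logspace machine. The numbers of states and configurations are
polynomial in `n`, and so is the running time; hence a constant number `t` of iterations of
`n ^ (ε / 2)`-th powers of the configuration matrix suffices. -/
theorem exists_constant_depth_of_machine {f : (n : ℕ) → (EdgeVar n → Bool) → Bool}
    (hmono : ∀ n, Monotone (f n)) (hgraph : ∀ n, IsGraphProperty (f n)) (M : NTM)
    (hpoly : M.IsPolyTime) (hspace : M.IsLogSpace) {φ : ℕ → Prop} {op : GateOp}
    (hφ : IsCounting φ op) {U : Set GateOp} (hU : andOr ⊆ U) (hop : op ∈ U)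
    (hM : ∀ n, 1 ≤ n → ∀ x, f n x = true ↔ φ (M.acceptingPaths (graphWord x)).ncard)
    {ε : ℝ} (hε : 0 < ε) :
    ∃ g : (N : ℕ) → (EdgeVar N → Bool) → Bool,
      (∀ N, Monotone (g N)) ∧ (∀ N, IsGraphProperty (g N)) ∧
        (∃ s : ℕ → ℕ, IsAlmostQuadratic s ∧ ∃ d, ∀ N, ∃ C : Circuit (EdgeVar N),
          C.Computes (g N) ∧ (∀ k, C.op k ∈ U) ∧ C.depth ≤ d ∧ C.size ≤ s N) ∧
        ∀ᶠ n : ℕ in atTop, IsMonotoneProjection (f n) (g ⌈(2 : ℝ) ^ ((n : ℝ) ^ ε)⌉₊) := by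
  classical
  let Nf : ℕ → ℕ := fun n => ⌈(2 : ℝ) ^ ((n : ℝ) ^ ε)⌉₊
  have hNf : ∀ n : ℕ, (2 : ℝ) ^ (n : ℝ) ^ ε ≤ Nf n := fun n => Nat.le_ceil _
  obtain ⟨n₀, hn₀⟩ := eventually_atTop.1 (((eventually_logb_le_rpow hε).and
    (eventually_logb_succ_sub_le hε)).and (eventually_ge_atTop 2))
  have h2 : ∀ n ≥ n₀, 2 ≤ n := fun n hn => (hn₀ n hn).2
  have hinj : Set.InjOn Nf {n | n₀ ≤ n} :=
    ceil_two_rpow_injOn (u := fun n => (n : ℝ) ^ ε) (by have := h2 n₀ le_rfl; omega)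
      (fun n hn => (hn₀ n hn).1.1) fun n hn => (hn₀ n hn).1.2
  have hle : ∀ n ≥ n₀, n ≤ Nf n := fun n hn =>
    le_ceil_two_rpow (u := fun n => (n : ℝ) ^ ε) (by have := h2 n hn; omega) (hn₀ n hn).1.1
  -- polynomial bounds
  let E := ⌈ε⌉₊
  have hNE : ∀ n, 1 ≤ n → Nf n ≤ 2 ^ n ^ E := by
    intro n hn
    rw [Nat.ceil_le, Nat.cast_pow, Nat.cast_ofNat, ← Real.rpow_natCast 2]
    apply Real.rpow_le_rpow_of_exponent_le (by norm_num)
    rw [Nat.cast_pow, ← Real.rpow_natCast]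
    exact Real.rpow_le_rpow_of_exponent_le (by exact_mod_cast hn) (Nat.le_ceil ε)
  obtain ⟨p, hp⟩ := hpoly
  obtain ⟨k, hk⟩ := hspace
  let len : ℕ → ℕ := fun n => (edgeList n).length
  let S : ℕ → ℕ := fun n => k * (Nat.log 2 (len n) + 1)
  have plen : PolyBdd len := (PolyBdd.id.mul PolyBdd.id).mono length_edgeList_le
  have pS : PolyBdd S := (PolyBdd.const k).mul (plen.log.add (PolyBdd.const 1))
  have pB : PolyBdd fun n => (2 * (n ^ 2 * n ^ E + 4) + 1) * (n + 1) :=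
    (((PolyBdd.const 2).mul (((PolyBdd.id.pow 2).mul (PolyBdd.id.pow E)).add
      (PolyBdd.const 4))).add (PolyBdd.const 1)).mul (PolyBdd.id.add (PolyBdd.const 1))
  have pV : PolyBdd fun n => Nat.card (BoundedConfig M (len n) (S n)) :=
    ((PolyBdd.const (Nat.card M.State)).mul ((plen.add (PolyBdd.const 2)).mul
      ((pS.add (PolyBdd.const 1)).mul (plen.exp_log (Nat.card M.Symbol) k)))).mono
      fun n => (boundedConfig_finite_card M (len n) (S n)).2
  have pT := plen.polynomial_eval p
  obtain ⟨C, hC⟩ := (pB.add (pV.add (PolyBdd.const 1))).add (pT.add (PolyBdd.const 1))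
  beta_reduce at hC
  let r : ℕ → ℕ := fun n => ⌈(n : ℝ) ^ (ε / 2)⌉₊
  let t := ⌈4 * C / ε⌉₊
  -- `t` is chosen such that `n ^ (t * ε / 2) ≥ n ^ (2 * C) ≥ (n + 2) ^ C`
  have hrt : ∀ n, 2 ≤ n → (n + 2) ^ C ≤ r n ^ t := by
    intro n hn
    have hn1 : (1 : ℝ) ≤ n := by exact_mod_cast (by omega : 1 ≤ n)
    have e1 : ((n ^ (2 * C) : ℕ) : ℝ) ≤ ((r n ^ t : ℕ) : ℝ) := by
      calc ((n ^ (2 * C) : ℕ) : ℝ) = (n : ℝ) ^ ((2 * C : ℕ) : ℝ) := by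
            rw [Real.rpow_natCast]; push_cast; rfl
        _ ≤ (n : ℝ) ^ (ε / 2 * t) := by
            apply Real.rpow_le_rpow_of_exponent_le hn1
            have : 4 * C / ε ≤ (t : ℝ) := Nat.le_ceil _
            rw [div_le_iff₀ hε] at this
            push_cast
            linarith
        _ = ((n : ℝ) ^ (ε / 2)) ^ t := by
            rw [Real.rpow_mul (by positivity), Real.rpow_natCast]
        _ ≤ (r n : ℝ) ^ t := pow_le_pow_left₀ (by positivity) (Nat.le_ceil _) t
        _ = _ := by push_cast; rfl
    calc (n + 2) ^ C ≤ (n ^ 2) ^ C := Nat.pow_le_pow_left (by nlinarith) C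
      _ = n ^ (2 * C) := by rw [pow_mul]
      _ ≤ _ := by exact_mod_cast e1
  have hcomp : ∀ n ≥ n₀, ∃ e, Comp U
      (16 * Nf n ^ 2 + (19 + 6 * t) * ((n + 2) ^ C) ^ (r n + 3)) (13 + 4 * t) e
      {fun x => padded (f n) (Nf n) x = true} := by
    intro n hn
    have hn2 := h2 n hn
    have hCn := hC n
    have hrtn := hrt n hn2
    have hr0 : 0 < r n :=
      Nat.ceil_pos.2 (Real.rpow_pos_of_pos (by exact_mod_cast (by omega : 0 < n)) _)
    refine comp_padded_machine (S := S n) (by omega) (hle n hn) (hNE n (by omega)) (hmono n)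
      (hgraph n) M hφ hU hop (hM n (by omega)) ?_ ?_ hr0 ?_ ?_ ?_
    · intro y l c h
      have := hk _ _ _ h
      rwa [graphWord_length] at this
    · intro y l c h
      have := hp _ _ _ h
      rw [graphWord_length] at this
      change _ ≤ p.eval (len n) at this
      have h3 : p.eval (len n) + 1 ≤ (n + 2) ^ C := by omega
      exact lt_of_lt_of_le (Nat.lt_succ_of_le this) (h3.trans hrtn)
    · refine le_trans ?_ hrtn
      have : 2 * (n ^ 2 * n ^ E + 4) ≤ (2 * (n ^ 2 * n ^ E + 4) + 1) * (n + 1) :=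
        (Nat.le_succ _).trans (Nat.le_mul_of_pos_right _ (Nat.succ_pos n))
      omega
    · omega
    · change Nat.card (BoundedConfig M (len n) (S n)) + 1 ≤ _
      omega
  let Sz : ℕ → ℕ := fun n => 16 * Nf n ^ 2 + (19 + 6 * t) * ((n + 2) ^ C) ^ (r n + 3)
  let s : ℕ → ℕ := fun N => 4 + if h : ∃ n, n₀ ≤ n ∧ Nf n = N then Sz h.choose else 0
  refine ⟨paddedFamily f Nf n₀, paddedFamily_monotone hmono, paddedFamily_isGraphProperty,
    ⟨s, ?_, 13 + 4 * t, ?_⟩, ?_⟩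
  · apply isAlmostQuadratic_of_eventually
    intro δ hδ
    obtain ⟨n₁, hn₁⟩ := eventually_atTop.1
      (eventually_size_le hε hδ C (19 + 6 * t) Nf hNf)
    filter_upwards [eventually_ge_atTop 2,
      eventually_gt_atTop ((Finset.range n₁).sup Nf)] with N hN2 hN
    have hN2' : (2 : ℝ) ≤ N := by exact_mod_cast hN2
    by_cases h : ∃ n, n₀ ≤ n ∧ Nf n = N
    · have hch := h.choose_spec.2
      have hge : n₁ ≤ h.choose := by
        by_contra hlt
        have : Nf h.choose ≤ (Finset.range n₁).sup Nf :=
          Finset.le_sup (f := Nf) (Finset.mem_range.2 (not_le.1 hlt))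
        omega
      have : ((4 + Sz h.choose : ℕ) : ℝ) ≤ (Nf h.choose : ℝ) ^ (2 + δ) := hn₁ _ hge
      simp only [s, dif_pos h]
      rwa [hch] at this
    · simp only [s, dif_neg h, add_zero]
      calc ((4 : ℕ) : ℝ) = (2 : ℝ) ^ (2 : ℝ) := by norm_num
        _ ≤ (N : ℝ) ^ (2 : ℝ) := Real.rpow_le_rpow (by norm_num) hN2' (by norm_num)
        _ ≤ _ := Real.rpow_le_rpow_of_exponent_le (by linarith) (by linarith)
  · intro N
    rcases paddedFamily_cases (f := f) (Nf := Nf) (n₀ := n₀) N with ⟨n, hn, rfl, hg⟩ | hg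
    · obtain ⟨e, hc⟩ := hcomp n hn
      obtain ⟨D, d1, d2, d3, d4⟩ := hc.exists_circuit rfl
      refine ⟨D, fun x => ?_, d2, d3, d1.trans ?_⟩
      · rw [hg, Bool.eq_iff_iff]; exact d4 x
      · have h : ∃ n', n₀ ≤ n' ∧ Nf n' = Nf n := ⟨n, hn, rfl⟩
        have hch : h.choose = n := hinj h.choose_spec.1 hn h.choose_spec.2
        simp only [s]
        rw [dif_pos h, hch]
        exact Nat.le_add_left _ _
    · obtain ⟨D, d1, d2, -, d4, d5⟩ := exists_circuit_false (ι := EdgeVar N) hU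
      exact ⟨D, hg ▸ d1, d2, d5.trans (by omega), d4.trans (Nat.le_add_right _ _)⟩
  · filter_upwards [eventually_ge_atTop n₀] with n hn
    exact isMonotoneProjection_paddedFamily hmono hgraph hinj hn (by have := h2 n hn; omega)
      (hle n hn)

theorem acceptingPaths_finite {M : NTM} (h : M.IsPolyTime) (w : List Bool) :
    (M.acceptingPaths w).Finite := by
  obtain ⟨p, hp⟩ := h
  rw [acceptingPaths_eq fun l c hl => Nat.lt_succ_of_le (hp w l c hl)]
  exact acceptingFrom_finite _ _ _

end GraphPadding

open GraphPadding in
theorem mainTheorem8 (f : (n : ℕ) → (EdgeVar n → Bool) → Bool)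
    (hmono : ∀ n, Monotone (f n)) (hgraph : ∀ n, IsGraphProperty (f n)) :
    (∀ i : ℕ, 1 < i → InNC i f →
      ∃ g : (N : ℕ) → (EdgeVar N → Bool) → Bool,
        (∀ N, Monotone (g N)) ∧ (∀ N, IsGraphProperty (g N)) ∧
        InNC 1 g ∧
        ∀ n : ℕ, 1 ≤ n →
          IsMonotoneProjection (f n) (g ⌈(2 : ℝ) ^ (Real.logb 2 (n : ℝ) ^ i)⌉₊)) ∧
    (InNL f → ∀ ε : ℝ, 0 < ε →
      ∃ g : (N : ℕ) → (EdgeVar N → Bool) → Bool,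
        (∀ N, Monotone (g N)) ∧ (∀ N, IsGraphProperty (g N)) ∧
        (∃ s : ℕ → ℕ, IsAlmostQuadratic s ∧ InAC0 s g) ∧
        ∀ᶠ n : ℕ in atTop,
          IsMonotoneProjection (f n) (g ⌈(2 : ℝ) ^ ((n : ℝ) ^ ε)⌉₊)) ∧
    (InParityL f → ∀ ε : ℝ, 0 < ε →
      ∃ g : (N : ℕ) → (EdgeVar N → Bool) → Bool,
        (∀ N, Monotone (g N)) ∧ (∀ N, IsGraphProperty (g N)) ∧
        (∃ s : ℕ → ℕ, IsAlmostQuadratic s ∧ InAC0Xor s g) ∧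
        ∀ᶠ n : ℕ in atTop,
          IsMonotoneProjection (f n) (g ⌈(2 : ℝ) ^ ((n : ℝ) ^ ε)⌉₊)) := by
  refine ⟨fun i hi h => exists_inNC_one_of_inNC hmono hgraph hi h, ?_, ?_⟩
  · rintro ⟨M, hpoly, hspace, hM⟩ ε hε
    obtain ⟨g, h1, h2, ⟨s, hs, d, hd⟩, h3⟩ := exists_constant_depth_of_machine hmono hgraph M hpoly
      hspace isCounting_ne_zero subset_rfl (by simp [andOr]) (fun n hn x => by
        rw [hM n hn x, ← Nat.pos_iff_ne_zero, Set.ncard_pos (acceptingPaths_finite hpoly _)]) hε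
    exact ⟨g, h1, h2, ⟨s, hs, d, hd⟩, h3⟩
  · rintro ⟨M, hpoly, hspace, hM⟩ ε hε
    obtain ⟨g, h1, h2, ⟨s, hs, d, hd⟩, h3⟩ := exists_constant_depth_of_machine hmono hgraph M hpoly
      hspace isCounting_odd (Set.subset_univ _) (Set.mem_univ _) hM hε
    refine ⟨g, h1, h2, ⟨s, hs, d, fun N => ?_⟩, h3⟩
    obtain ⟨C, c1, -, c2⟩ := hd N
    exact ⟨C, c1, c2⟩
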